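/- Let $q$ be a real number with $-1<q<1$, let $m\ge 0$, and let $\boldsymbol n=(n_1,\dots,n_m)$ be an $m$-tuple of nonnegative integers with $n=n_1+\cdots+n_m$. Split $\{1,\dots,n\}$ into the consecutive boxes $S_j=\{n_1+\cdots+n_{j-1}+1,\dots,n_1+\cdots+n_j\}$, $1\le j\le m$. Let $\mathcal K(\boldsymbol n)$ be the set of inhomogeneous perfect matchings, that is, of the partitions of $\{1,\dots,n\}$ into two-element blocks none of which is contained in a box. Write a block $\{i,j\}$ with $i<j$ as an arc $(i,j)$, let $\mathrm{cr}(M)$ be the number of pairs of arcs $(i,j),(k,\ell)$ of $M$ with $i<k<j<\ell$, and set $$K(\boldsymbol n|q)=\sum_{M\in\mathcal K(\boldsymbol n)}q^{\mathrm{cr}(M)}\qquad(0^0=1).$$ Let $H_n(x|q)$ be the continuous $q$-Hermite polynomials, defined by $H_0(x|q)=1$, $H_1(x|q)=2x$ and $2xH_n(x|q)=H_{n+1}(x|q)+(1-q^n)H_{n-1}(x|q)$ for $n>0$, and let $\tilde H_n(x|q)=a^{-n}H_n\!\left(\tfrac12 ax\,\middle|\,q\right)$ with $a=\sqrt{1-q}$.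 Let $$\tilde v(x|q)=\frac{\sqrt{1-q}\;\prod_{k\ge1}(1-q^k)}{4\pi\sqrt{1-(1-q)x^2/4}}\prod_{k=0}^\infty\left\{1+(2-x^2(1-q))q^k+q^{2k}\right\}\quad\text{for } |x|<\frac{2}{\sqrt{1-q}},$$ and $\tilde v(x|q)=0$ for all other real $x$. Then $x\mapsto\tilde v(x|q)\prod_{j=1}^m\tilde H_{n_j}(x|q)$ is integrable on $\mathbb R$ and $$K(\boldsymbol n|q)=\int_{\mathbb R}\tilde v(x|q)\prod_{j=1}^m\tilde H_{n_j}(x|q)\,dx .$$ -/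

import Mathlib

namespace QHermite

/-! ### Inhomogeneous perfect matchings

For `n = (n_1, …, n_m)`, the balls are the elements of `Fin (∑ j, n j)`
(numbered from `0` instead of from `1`), split into consecutive boxes of sizes `n_1, …, n_m`. -/

/-- The box `S_j`: the balls `i` with `n_1 + ⋯ + n_{j-1} ≤ i < n_1 + ⋯ + n_j`. -/
def box {m : ℕ} (n : Fin m → ℕ) (j : Fin m) : Finset (Fin (∑ j, n j)) :=
  Finset.univ.filter fun i =>
    ∑ k ∈ Finset.Iio j, n k ≤ (i : ℕ) ∧ (i : ℕ) < ∑ k ∈ Finset.Iic j, n k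

/-- A perfect matching of `{0, …, N - 1}` is a set partition all of whose blocks have
exactly two elements. -/
def IsPerfectMatching {N : ℕ} (M : Finpartition (Finset.univ : Finset (Fin N))) : Prop :=
  ∀ B ∈ M.parts, B.card = 2

/-- No two distinct elements of a block lie in the same box. (The further requirement on an
inhomogeneous partition, that each block has at least two elements, is part of
`IsPerfectMatching`.) -/
def IsInhomogeneous {m : ℕ} (n : Fin m → ℕ)
    (M : Finpartition (Finset.univ : Finset (Fin (∑ j, n j)))) : Prop :=
  ∀ B ∈ M.parts, ∀ x ∈ B, ∀ y ∈ B, x ≠ y → ∀ j, ¬ (x ∈ box n j ∧ y ∈ box n j)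

/-- The arcs `(i, j)`, `i < j`, of a perfect matching. -/
def arcs {N : ℕ} (M : Finpartition (Finset.univ : Finset (Fin N))) : Finset (Fin N × Fin N) :=
  Finset.univ.filter fun e => e.1 < e.2 ∧ {e.1, e.2} ∈ M.parts

/-- The number of crossings of a perfect matching: pairs of arcs `((i, j), (k, l))` with
`i < k < j < l`. -/
def cr {N : ℕ} (M : Finpartition (Finset.univ : Finset (Fin N))) : ℕ :=
  ((arcs M ×ˢ arcs M).filter fun p =>
    p.1.1 < p.2.1 ∧ p.2.1 < p.1.2 ∧ p.1.2 < p.2.2).card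

open Classical in
/-- The set of inhomogeneous perfect matchings of the boxed set `[n]`. -/
noncomputable def inhomMatchings {m : ℕ} (n : Fin m → ℕ) :
    Finset (Finpartition (Finset.univ : Finset (Fin (∑ j, n j)))) :=
  Finset.univ.filter fun M => IsPerfectMatching M ∧ IsInhomogeneous n M

/-- `K(n|q)`, the generating polynomial of inhomogeneous perfect matchings by crossings. -/
noncomputable def K {m : ℕ} (n : Fin m → ℕ) (q : ℝ) : ℝ :=
  ∑ M ∈ inhomMatchings n, q ^ cr M

/-! ### Continuous `q`-Hermite polynomials -/

/-- The continuous `q`-Hermite polynomials: `H_0 = 1`, `H_1 = 2x`,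
`2x H_n = H_{n+1} + (1 - q^n) H_{n-1}` for `n > 0`. -/
noncomputable def contHermite (q : ℝ) : ℕ → Polynomial ℝ
  | 0 => 1
  | 1 => 2 * Polynomial.X
  | n + 2 => 2 * Polynomial.X * contHermite q (n + 1)
      - Polynomial.C (1 - q ^ (n + 1)) * contHermite q n

/-- The rescaled polynomials `H̃_n(x|q) = H_n(a x / 2 | q) / a^n`, `a = √(1 - q)`. -/
noncomputable def rescaledHermite (q : ℝ) (n : ℕ) (x : ℝ) : ℝ :=
  (contHermite q n).eval (1 / 2 * √(1 - q) * x) / √(1 - q) ^ n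

/-- The infinite `q`-shifted factorial `(q; q)_∞ = ∏_{k ≥ 1} (1 - q^k)`. -/
noncomputable def qPochInfty (q : ℝ) : ℝ := ∏' k : ℕ, (1 - q ^ (k + 1))

open Classical in
/-- The weight `ṽ(x|q)`, supported on `|x| ≤ 2 / √(1 - q)`
(its values at the two end points are irrelevant). -/
noncomputable def weight (q : ℝ) (x : ℝ) : ℝ :=
  if |x| < 2 / √(1 - q) then
    √(1 - q) * qPochInfty q / (√(1 - (1 - q) * x ^ 2 / 4) * (4 * Real.pi)) *
      ∏' k : ℕ, (1 + (2 - x ^ 2 * (1 - q)) * q ^ k + q ^ (2 * k))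
  else 0

end QHermite

/-! The product of the `rescaledHermite q (n j)` linearizes over partial matchings. Join some points
of different boxes by arcs, leave the rest open, and count each open point as the left end of an arc
running off to the right; then `prod_rescaledHermite` writes the product as the sum of `q ^ openCr`
times `rescaledHermite` at the number of open points. Integration against `weight` kills every term
with an open point and gives 1 otherwise (`integral_weight_mul_rescaledHermite`). What remains is
the sum over perfect matchings, which is `K` (`K_eq_sum_partialMatchings`).

The expansion is built box by box (`matchingSum_box`). With `h` open points before the current box
and `o` inside it, a new point stays open or closes one of the `h`, with total weight `q ^ o * [h]`.
Since `[h + o] = [o] + q ^ o * [h]`, this matches the three-term recurrence up to a term with factor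
`[o]`, which `matchingSum_lower` evaluates by a `q`-commutation relation.

For the integral, put `x = 2 cos θ / √(1 - q)`. Odd degrees vanish by symmetry. For degree `2 * r`,
truncate the infinite product: up to a factor tending to 1, the integrand is a polynomial in
`e^{2iθ}` times a power of `e^{-2iθ}`, so the integral is one coefficient of a Rogers–Szegő
polynomial times a theta product. The finite Jacobi triple product (`coeff_thetaPoly`) gives these
coefficients, and their limit is a multiple of the finite theta product at 1, which is zero unless
`r = 0`. -/

namespace QHermite

/-! ### Partial matchings and their crossings -/

open Finset

/-- The `q`-integer `[n] = 1 + q + ⋯ + q^(n-1)`. -/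
noncomputable def qInt (q : ℝ) (n : ℕ) : ℝ := ∑ j ∈ range n, q ^ j

@[simp] lemma qInt_zero (q : ℝ) : qInt q 0 = 0 := by simp [qInt]

lemma qInt_succ (q : ℝ) (n : ℕ) : qInt q (n + 1) = qInt q n + q ^ n := by
  simp [qInt, sum_range_succ]

lemma qInt_succ' (q : ℝ) (n : ℕ) : qInt q (n + 1) = 1 + q * qInt q n := by
  simp only [qInt, sum_range_succ', mul_sum, pow_zero, pow_succ']
  ring

lemma qInt_add (q : ℝ) (m n : ℕ) : qInt q (m + n) = qInt q m + q ^ m * qInt q n := by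
  simp only [qInt, sum_range_add, mul_sum, pow_add]

lemma one_sub_mul_qInt (q : ℝ) (n : ℕ) : (1 - q) * qInt q n = 1 - q ^ n :=
  mul_neg_geom_sum q n

/-- A set of arcs on the points `0, …, N - 1`, no two of which share an end point, and whose
end points are related by `R`. -/
def IsPartialMatching (R : ℕ → ℕ → Prop) (N : ℕ) (A : Finset (ℕ × ℕ)) : Prop :=
  (∀ e ∈ A, e.1 < e.2 ∧ e.2 < N ∧ R e.1 e.2) ∧
    ∀ e ∈ A, ∀ f ∈ A, e ≠ f → e.1 ≠ f.1 ∧ e.1 ≠ f.2 ∧ e.2 ≠ f.1 ∧ e.2 ≠ f.2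

open Classical in
/-- The partial matchings of `{0, …, N - 1}` with arcs in `R`. -/
noncomputable def partialMatchings (R : ℕ → ℕ → Prop) (N : ℕ) : Finset (Finset (ℕ × ℕ)) :=
  (range N ×ˢ range N).powerset.filter (IsPartialMatching R N)

/-- The points of `{0, …, N - 1}` not covered by an arc. -/
def openPts (N : ℕ) (A : Finset (ℕ × ℕ)) : Finset ℕ :=
  (range N).filter fun i => ∀ e ∈ A, i ≠ e.1 ∧ i ≠ e.2

/-- The number of crossings of a partial matching, where each open point is regarded as the left
end of an arc that ends to the right of all points. -/
def openCr (N : ℕ) (A : Finset (ℕ × ℕ)) : ℕ :=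
  ∑ e ∈ A, ((A.filter fun f => e.1 < f.1 ∧ f.1 < e.2 ∧ e.2 < f.2).card +
    ((openPts N A).filter fun k => e.1 < k ∧ k < e.2).card)

lemma mem_partialMatchings {R : ℕ → ℕ → Prop} {N : ℕ} {A : Finset (ℕ × ℕ)} :
    A ∈ partialMatchings R N ↔ IsPartialMatching R N A := by
  simp only [partialMatchings, mem_filter, mem_powerset, and_iff_right_iff_imp]
  intro h e he
  have := h.1 e he
  simp only [mem_product, mem_range]
  omega

lemma mem_openPts {N i : ℕ} {A : Finset (ℕ × ℕ)} :
    i ∈ openPts N A ↔ i < N ∧ ∀ e ∈ A, i ≠ e.1 ∧ i ≠ e.2 := by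
  simp [openPts]

lemma IsPartialMatching.mono {R : ℕ → ℕ → Prop} {N : ℕ} {A : Finset (ℕ × ℕ)}
    (h : IsPartialMatching R N A) : IsPartialMatching R (N + 1) A :=
  ⟨fun e he => ⟨(h.1 e he).1, by have := (h.1 e he).2.1; omega, (h.1 e he).2.2⟩, h.2⟩

lemma IsPartialMatching.insert_last {R : ℕ → ℕ → Prop} {N i : ℕ} {A : Finset (ℕ × ℕ)}
    (h : IsPartialMatching R N A) (hi : i ∈ openPts N A) (hR : R i N) :
    IsPartialMatching R (N + 1) (insert (i, N) A) := by
  rw [mem_openPts] at hi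
  refine ⟨?_, ?_⟩
  · intro e he
    rcases mem_insert.1 he with rfl | he
    · exact ⟨hi.1, by simp, hR⟩
    · exact h.mono.1 e he
  · have key : ∀ f ∈ A, i ≠ f.1 ∧ i ≠ f.2 ∧ N ≠ f.1 ∧ N ≠ f.2 := fun f hf => by
      have h1 := h.1 f hf
      have h2 := hi.2 f hf
      refine ⟨h2.1, h2.2, ?_, ?_⟩ <;> omega
    intro e he f hf hef
    rcases mem_insert.1 he with rfl | he <;> rcases mem_insert.1 hf with rfl | hf
    · exact absurd rfl hef
    · exact key f hf
    · obtain ⟨h1, h2, h3, h4⟩ := key e he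
      exact ⟨h1.symm, h3.symm, h2.symm, h4.symm⟩
    · exact h.2 e he f hf hef

lemma notMem_of_mem_openPts {N i j : ℕ} {A : Finset (ℕ × ℕ)} (hi : i ∈ openPts N A) :
    (i, j) ∉ A := fun h => ((mem_openPts.1 hi).2 _ h).1 rfl

lemma IsPartialMatching.filter_insert_last {R : ℕ → ℕ → Prop} {N i : ℕ} {A : Finset (ℕ × ℕ)}
    (h : IsPartialMatching R N A) : (insert (i, N) A).filter (fun e => e.2 ≠ N) = A := by
  rw [filter_insert, if_neg (by simp), filter_true_of_mem]
  intro e he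
  have := (h.1 e he).2.1
  omega

open Classical in
/-- A partial matching of `N + 1` points arises from one of `N` points by leaving the last point
open or by joining it to an open point. -/
lemma sum_partialMatchings_succ (R : ℕ → ℕ → Prop) (N : ℕ) (F : Finset (ℕ × ℕ) → ℝ) :
    ∑ A ∈ partialMatchings R (N + 1), F A =
      ∑ A ∈ partialMatchings R N,
        (F A + ∑ i ∈ (openPts N A).filter (fun i => R i N), F (insert (i, N) A)) := by
  rw [sum_add_distrib, ← sum_filter_add_sum_filter_not _ (fun A => ∀ e ∈ A, e.2 ≠ N)]
  congr 1
  · refine sum_congr ?_ fun _ _ => rfl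
    ext A
    simp only [mem_filter, mem_partialMatchings]
    refine ⟨fun ⟨h, hN⟩ => ⟨fun e he => ?_, h.2⟩, fun h => ⟨h.mono, fun e he => ?_⟩⟩
    · have h1 := h.1 e he
      have h2 := hN e he
      exact ⟨h1.1, by omega, h1.2.2⟩
    · have := (h.1 e he).2.1
      omega
  · rw [sum_sigma']
    symm
    refine sum_bij (fun p _ => insert (p.2, N) p.1) ?_ ?_ ?_ fun _ _ => rfl
    · rintro ⟨A, i⟩ h
      simp only [mem_sigma, mem_filter, mem_partialMatchings] at h ⊢
      refine ⟨h.1.insert_last h.2.1 h.2.2, fun hN => hN (i, N) (mem_insert_self _ _) rfl⟩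
    · rintro ⟨A, i⟩ hA ⟨B, j⟩ hB heq
      simp only [mem_sigma, mem_filter, mem_partialMatchings] at hA hB heq
      -- Discarding the arc that ends at `N` recovers the smaller matching.
      have hAB : A = B := by
        rw [← hA.1.filter_insert_last (i := i), heq, hB.1.filter_insert_last]
      subst hAB
      have : (i, N) ∈ insert (j, N) A := heq ▸ mem_insert_self _ _
      rcases mem_insert.1 this with h | h
      · simpa using h
      · exact absurd h (notMem_of_mem_openPts hA.2.1)
    · intro A hA
      simp only [mem_filter, mem_partialMatchings, not_forall, not_not] at hA
      obtain ⟨hA, e, he, heN⟩ := hA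
      have hne : ∀ f ∈ A.erase e, f.2 < N := fun f hf => by
        have h1 := (hA.1 f (mem_of_mem_erase hf)).2.1
        have h2 := (hA.2 f (mem_of_mem_erase hf) e he (ne_of_mem_erase hf)).2.2.2
        omega
      refine ⟨⟨A.erase e, e.1⟩, ?_, ?_⟩
      · simp only [mem_sigma, mem_filter, mem_partialMatchings]
        refine ⟨⟨fun f hf => ⟨(hA.1 f (mem_of_mem_erase hf)).1, hne f hf,
          (hA.1 f (mem_of_mem_erase hf)).2.2⟩, fun f hf g hg =>
          hA.2 f (mem_of_mem_erase hf) g (mem_of_mem_erase hg)⟩, ?_, ?_⟩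
        · rw [mem_openPts]
          refine ⟨by have := (hA.1 e he).1; omega, fun f hf => ?_⟩
          have h2 := hA.2 e he f (mem_of_mem_erase hf) (ne_of_mem_erase hf).symm
          exact ⟨h2.1, h2.2.1⟩
        · have := (hA.1 e he).2.2
          rwa [heN] at this
      · simp only [← heN, Prod.mk.eta]
        exact insert_erase he

lemma IsPartialMatching.openPts_succ {R : ℕ → ℕ → Prop} {N : ℕ} {A : Finset (ℕ × ℕ)}
    (h : IsPartialMatching R N A) : openPts (N + 1) A = insert N (openPts N A) := by
  ext i
  simp only [mem_openPts, mem_insert]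
  constructor
  · rintro ⟨h1, h2⟩
    by_cases hi : i = N
    · exact Or.inl hi
    · exact Or.inr ⟨by omega, h2⟩
  · rintro (rfl | ⟨h1, h2⟩)
    · refine ⟨by omega, fun e he => ?_⟩
      have := h.1 e he
      omega
    · exact ⟨by omega, h2⟩

/-- The new open point lies to the right of every arc, so no arc covers it. -/
lemma IsPartialMatching.openCr_succ {R : ℕ → ℕ → Prop} {N : ℕ} {A : Finset (ℕ × ℕ)}
    (h : IsPartialMatching R N A) : openCr (N + 1) A = openCr N A := by
  unfold openCr
  refine sum_congr rfl fun e he => ?_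
  rw [h.openPts_succ, filter_insert, if_neg]
  have := h.1 e he
  omega

lemma openPts_insert_last (N i : ℕ) (A : Finset (ℕ × ℕ)) :
    openPts (N + 1) (insert (i, N) A) = (openPts N A).erase i := by
  ext j
  simp only [mem_openPts, mem_erase, forall_mem_insert]
  constructor
  · rintro ⟨h1, ⟨h2, h3⟩, h4⟩
    exact ⟨h2, by omega, h4⟩
  · rintro ⟨h1, h2, h4⟩
    exact ⟨by omega, ⟨h1, by omega⟩, h4⟩

/-- An old arc over `i` exchanges its crossing with the open point `i` for one with the arc `(i,
N)`. The only new crossings are those of `(i, N)` with the open points to the right of `i`. -/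
lemma IsPartialMatching.openCr_insert_last {R : ℕ → ℕ → Prop} {N i : ℕ} {A : Finset (ℕ × ℕ)}
    (h : IsPartialMatching R N A) (hi : i ∈ openPts N A) :
    openCr (N + 1) (insert (i, N) A) =
      openCr N A + ((openPts N A).filter fun k => i < k).card := by
  unfold openCr
  rw [sum_insert (notMem_of_mem_openPts hi), openPts_insert_last, add_comm]
  congr 1
  · refine sum_congr rfl fun e he => ?_
    have h1 := h.1 e he
    rw [filter_insert, filter_erase]
    by_cases hc : e.1 < i ∧ i < e.2
    · rw [if_pos ⟨hc.1, hc.2, h1.2.1⟩, card_insert_of_notMem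
        (fun hm => notMem_of_mem_openPts hi (mem_filter.1 hm).1), add_assoc, add_comm 1,
        card_erase_add_one (mem_filter.2 ⟨hi, hc⟩)]
    · have hm : i ∉ (openPts N A).filter fun k => e.1 < k ∧ k < e.2 := fun hm =>
        hc (mem_filter.1 hm).2
      rw [if_neg (fun hh => hc ⟨hh.1, hh.2.1⟩), erase_eq_of_notMem hm]
  · rw [filter_eq_empty_iff.2, card_empty, zero_add]
    · congr 1
      ext k
      simp only [mem_filter, mem_erase, mem_openPts]
      constructor
      · rintro ⟨⟨-, h1⟩, h2, -⟩
        exact ⟨h1, h2⟩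
      · rintro ⟨h1, h2⟩
        exact ⟨⟨by omega, h1⟩, h2, h1.1⟩
    · intro e he
      rcases mem_insert.1 he with rfl | he
      · simp
      · have := h.1 e he
        simp only [not_and]
        intros
        omega

/-! ### Weighted sums over partial matchings, one box at a time -/

lemma sum_pow_card_filter_lt (q : ℝ) (S : Finset ℕ) :
    ∑ i ∈ S, q ^ (S.filter fun k => i < k).card = qInt q S.card := by
  induction S using Finset.induction_on_min with
  | empty => simp
  | insert a S ha ih =>
    have haS : a ∉ S := fun h => lt_irrefl _ (ha a h)
    rw [sum_insert haS, card_insert_of_notMem haS, qInt_succ, ← ih, add_comm]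
    congr 1
    · refine sum_congr rfl fun i hi => ?_
      rw [filter_insert, if_neg (by have := ha i hi; omega)]
    · rw [filter_insert, if_neg (lt_irrefl a), filter_true_of_mem ha]

/-- All points from `t` on lie to the right of each `i < t`, so they contribute a common factor. -/
lemma sum_pow_card_filter_lt_of_lt (q : ℝ) (S : Finset ℕ) (t : ℕ) :
    ∑ i ∈ S.filter (fun i => i < t), q ^ (S.filter fun k => i < k).card =
      q ^ (S.filter fun k => t ≤ k).card * qInt q (S.filter fun i => i < t).card := by
  rw [← sum_pow_card_filter_lt, mul_sum]
  refine sum_congr rfl fun i hi => ?_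
  rw [mem_filter] at hi
  rw [← pow_add, ← card_union_of_disjoint]
  · congr 2
    ext k
    simp only [mem_filter, mem_union]
    constructor
    · rintro ⟨h1, h2⟩
      by_cases hk : t ≤ k
      · exact Or.inl ⟨h1, hk⟩
      · exact Or.inr ⟨⟨h1, by omega⟩, h2⟩
    · rintro (⟨h1, h2⟩ | ⟨⟨h1, h2⟩, h3⟩)
      · exact ⟨h1, by omega⟩
      · exact ⟨h1, h3⟩
  · rw [disjoint_left]
    intro k hk hk'
    simp only [mem_filter] at hk hk'
    omega

/-- The sum over all partial matchings of `q ^ openCr` times a function of the numbers of open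
points to the left and to the right of `t`. -/
noncomputable def matchingSum (q : ℝ) (R : ℕ → ℕ → Prop) (N t : ℕ) (g : ℕ → ℕ → ℝ) : ℝ :=
  ∑ A ∈ partialMatchings R N, q ^ openCr N A *
    g ((openPts N A).filter fun i => i < t).card ((openPts N A).filter fun i => t ≤ i).card

/-- The two terms correspond to leaving `N` open and to joining it to an open point before `t`. For
`h = 0` the truncated `h - 1` is harmless because `[0] = 0`. -/
lemma matchingSum_succ (q : ℝ) {R : ℕ → ℕ → Prop} {N t : ℕ} (ht : t ≤ N)
    (hR : ∀ i, R i N ↔ i < t) (g : ℕ → ℕ → ℝ) :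
    matchingSum q R (N + 1) t g = matchingSum q R N t fun h o =>
      g h (o + 1) + q ^ o * qInt q h * g (h - 1) o := by
  unfold matchingSum
  rw [sum_partialMatchings_succ]
  refine sum_congr rfl fun A hA => ?_
  rw [mem_partialMatchings] at hA
  rw [mul_add]
  congr 1
  · have hN : N ∉ (openPts N A).filter fun i => t ≤ i := fun h =>
      absurd (mem_openPts.1 (mem_filter.1 h).1).1 (lt_irrefl _)
    rw [hA.openCr_succ, hA.openPts_succ, filter_insert, filter_insert, if_neg (by omega),
      if_pos ht, card_insert_of_notMem hN]
  · simp only [hR]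
    rw [← sum_pow_card_filter_lt_of_lt, sum_mul, mul_sum]
    refine sum_congr rfl fun i hi => ?_
    have hi' := mem_filter.1 hi
    rw [hA.openCr_insert_last hi'.1, openPts_insert_last, filter_erase, filter_erase,
      card_erase_of_mem hi, erase_eq_of_notMem (a := i), pow_add, mul_assoc]
    intro hm
    have := (mem_filter.1 hm).2
    omega

lemma matchingSum_add (q : ℝ) (R : ℕ → ℕ → Prop) (N t : ℕ) (f g : ℕ → ℕ → ℝ) :
    matchingSum q R N t (fun h o => f h o + g h o) =
      matchingSum q R N t f + matchingSum q R N t g := by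
  simp only [matchingSum, mul_add, sum_add_distrib]

lemma matchingSum_mul (q : ℝ) (R : ℕ → ℕ → Prop) (N t : ℕ) (c : ℝ) (g : ℕ → ℕ → ℝ) :
    matchingSum q R N t (fun h o => c * g h o) = c * matchingSum q R N t g := by
  simp only [matchingSum, mul_sum]
  exact sum_congr rfl fun _ _ => by ring

lemma matchingSum_lower_zero (q : ℝ) (R : ℕ → ℕ → Prop) (t : ℕ) (g : ℕ → ℕ → ℝ) :
    matchingSum q R t t (fun h o => qInt q o * g h (o - 1)) = 0 := by
  unfold matchingSum
  refine sum_eq_zero fun A _ => ?_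
  rw [filter_false_of_mem (p := fun i => t ≤ i)]
  · simp
  · intro i hi
    have := (mem_openPts.1 hi).1
    omega

/-- Let `D` send `g` to `[o] * g h (o - 1)` and let `T` be the transfer operator of
`matchingSum_succ`. Then `T D = 1 + q D T`, so moving `D` past one point at a time builds up `[k +
1] = 1 + q * [k]`; at the start of the box `D` contributes zero. -/
lemma matchingSum_lower (q : ℝ) {R : ℕ → ℕ → Prop} {t k : ℕ}
    (hR : ∀ l, t ≤ l → l < t + (k + 1) → ∀ i, R i l ↔ i < t) (g : ℕ → ℕ → ℝ) :
    matchingSum q R (t + (k + 1)) t (fun h o => qInt q o * g h (o - 1)) =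
      qInt q (k + 1) * matchingSum q R (t + k) t g := by
  induction k generalizing g with
  | zero =>
    have h0 := matchingSum_lower_zero q R t
      (fun h o => q * (g h (o + 1) + q ^ o * qInt q h * g (h - 1) o))
    rw [← add_assoc, matchingSum_succ q (by omega) (hR _ (by omega) (by omega))]
    have : (fun h o => qInt q (o + 1) * g h (o + 1 - 1) +
        q ^ o * qInt q h * (qInt q o * g (h - 1) (o - 1))) = fun h o => g h o +
        qInt q o * (fun h o => q * (g h (o + 1) + q ^ o * qInt q h * g (h - 1) o)) h (o - 1) := by
      funext h o
      cases o with
      | zero => simp [qInt_succ]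
      | succ o => simp only [qInt_succ' q (o + 1), Nat.add_sub_cancel, pow_succ]; ring
    rw [this, matchingSum_add]
    simp only [add_zero, zero_add] at h0 ⊢
    rw [h0]
    simp [qInt]
  | succ k ih =>
    have h0 := ih (fun l h1 h2 => hR l h1 (by omega))
      (fun h o => g h (o + 1) + q ^ o * qInt q h * g (h - 1) o)
    rw [← matchingSum_succ q (by omega) (hR _ (by omega) (by omega))] at h0
    rw [← add_assoc, matchingSum_succ q (by omega) (hR _ (by omega) (by omega))]
    have : (fun h o => qInt q (o + 1) * g h (o + 1 - 1) +
        q ^ o * qInt q h * (qInt q o * g (h - 1) (o - 1))) = fun h o => g h o +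
        q * (qInt q o * (fun h o => (g h (o + 1) + q ^ o * qInt q h * g (h - 1) o)) h (o - 1)) := by
      funext h o
      cases o with
      | zero => simp [qInt_succ]
      | succ o => simp only [qInt_succ' q (o + 1), Nat.add_sub_cancel, pow_succ]; ring
    rw [this, matchingSum_add, matchingSum_mul, h0, qInt_succ' q (k + 1), add_assoc]
    ring

/-- Attaching a box of `k` points multiplies the sum by `η k`. -/
lemma matchingSum_box {q x : ℝ} {η : ℕ → ℝ} (h0 : η 0 = 1)
    (hη : ∀ n, η (n + 1) = x * η n - qInt q n * η (n - 1)) {R : ℕ → ℕ → Prop} {t : ℕ} (k : ℕ)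
    (hR : ∀ l, t ≤ l → l < t + k → ∀ i, R i l ↔ i < t) :
    matchingSum q R (t + k) t (fun h o => η (h + o)) =
      η k * matchingSum q R t t (fun h o => η (h + o)) := by
  -- The transfer operator applied to `η (h + o)` gives `x * η (h + o)` minus the part of `[h + o] *
  -- η (h + o - 1)` with factor `[o]`. With `matchingSum_lower`, the sums then satisfy the
  -- recurrence of `η` in the size of the box.
  have key : ∀ N, t ≤ N → (∀ i, R i N ↔ i < t) →
      matchingSum q R (N + 1) t (fun h o => η (h + o)) =
        x * matchingSum q R N t (fun h o => η (h + o)) -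
        matchingSum q R N t (fun h o => qInt q o * (fun h o => η (h + o)) h (o - 1)) := by
    intro N hN hRN
    rw [matchingSum_succ q hN hRN, ← matchingSum_mul, eq_sub_iff_add_eq, ← matchingSum_add]
    congr 1
    funext h o
    have h1 := hη (h + o)
    rw [add_comm h o, qInt_add, add_comm o h] at h1
    rw [← add_assoc, h1]
    cases o with
    | zero => simp
    | succ o =>
      cases h with
      | zero => simp
      | succ h =>
        simp only [Nat.add_sub_cancel]
        rw [show h + 1 + (o + 1) - 1 = h + (o + 1) by omega, show h + 1 + o = h + (o + 1) by omega]
        ring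
  induction k using Nat.twoStepInduction with
  | zero => simp [h0]
  | one =>
    rw [key t le_rfl (hR t le_rfl (by omega)),
      matchingSum_lower_zero q R t (fun h o => η (h + o)), hη 0, h0]
    simp
  | more k ih1 ih2 =>
    rw [show t + (k + 2) = t + (k + 1) + 1 by ring,
      key _ (by omega) (hR _ (by omega) (by omega)),
      matchingSum_lower q (fun l h1 h2 => hR l h1 (by omega)) (fun h o => η (h + o)),
      ih1 (fun l h1 h2 => hR l h1 (by omega)), ih2 (fun l h1 h2 => hR l h1 (by omega)),
      hη (k + 1)]
    simp only [Nat.add_sub_cancel]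
    ring

lemma matchingSum_eq_sum (q : ℝ) (R : ℕ → ℕ → Prop) (N t : ℕ) (η : ℕ → ℝ) :
    matchingSum q R N t (fun h o => η (h + o)) =
      ∑ A ∈ partialMatchings R N, q ^ openCr N A * η (openPts N A).card := by
  unfold matchingSum
  refine sum_congr rfl fun A _ => ?_
  simp only [← not_lt]
  rw [card_filter_add_card_filter_not]

/-- If the points are split into consecutive boxes, the `j`-th of which starts at `T j`, and `R`
relates points in different boxes, then the product of the `η` at the box sizes is a sum over
partial matchings. -/
lemma prod_eq_sum_partialMatchings {q x : ℝ} {η : ℕ → ℝ} (h0 : η 0 = 1)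
    (hη : ∀ n, η (n + 1) = x * η n - qInt q n * η (n - 1)) {R : ℕ → ℕ → Prop} (T s : ℕ → ℕ)
    (hT0 : T 0 = 0) (m : ℕ) (hT : ∀ j < m, T (j + 1) = T j + s j)
    (hR : ∀ j < m, ∀ l, T j ≤ l → l < T (j + 1) → ∀ i, R i l ↔ i < T j) :
    ∏ j ∈ range m, η (s j) =
      ∑ A ∈ partialMatchings R (T m), q ^ openCr (T m) A * η (openPts (T m) A).card := by
  induction m with
  | zero =>
    have : partialMatchings R 0 = {∅} := by
      ext A
      rw [mem_partialMatchings, mem_singleton]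
      refine ⟨fun h => eq_empty_of_forall_notMem fun e he => ?_, ?_⟩
      · have := (h.1 e he).2.1
        omega
      · rintro rfl
        simp [IsPartialMatching]
    simp [hT0, this, openCr, openPts, h0]
  | succ m ih =>
    rw [prod_range_succ, ih (fun j hj => hT j (by omega)) (fun j hj => hR j (by omega)),
      ← matchingSum_eq_sum q R (T m) (T m), ← matchingSum_eq_sum q R (T (m + 1)) (T m),
      hT m (by omega), matchingSum_box h0 hη _ (hT m (by omega) ▸ hR m (by omega)), mul_comm]

end QHermite

namespace QHermite

/-! ### Perfect matchings as partial matchings without open points -/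

open Finset

/-- The start `n_1 + ⋯ + n_j` of the box with (zero-based) index `j`. -/
def boxStart {m : ℕ} (n : Fin m → ℕ) (j : ℕ) : ℕ :=
  ∑ i ∈ range j, if h : i < m then n ⟨i, h⟩ else 0

/-- Two points are separated if a box starts between them. -/
def Separated {m : ℕ} (n : Fin m → ℕ) (i l : ℕ) : Prop :=
  ∃ j < m, i < boxStart n j ∧ boxStart n j ≤ l

lemma boxStart_succ {m : ℕ} (n : Fin m → ℕ) (j : Fin m) :
    boxStart n (j + 1) = boxStart n j + n j := by
  simp [boxStart, sum_range_succ]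

lemma boxStart_mono {m : ℕ} (n : Fin m → ℕ) : Monotone (boxStart n) :=
  fun _ _ h => sum_le_sum_of_subset (range_subset_range.2 h)

lemma boxStart_last {m : ℕ} (n : Fin m → ℕ) : boxStart n m = ∑ j, n j := by
  rw [boxStart, sum_range]
  simp

lemma sum_Iio_eq_boxStart {m : ℕ} (n : Fin m → ℕ) (j : Fin m) :
    ∑ k ∈ Iio j, n k = boxStart n j := by
  unfold boxStart
  refine sum_bij (fun k _ => (k : ℕ)) ?_ ?_ ?_ ?_
  · intro k hk
    simpa using hk
  · intro a _ b _ h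
    exact Fin.ext h
  · intro b hb
    have hb := mem_range.1 hb
    exact ⟨⟨b, hb.trans j.2⟩, by simpa [Fin.lt_def] using hb, rfl⟩
  · intro k _
    simp

lemma sum_Iic_eq_boxStart {m : ℕ} (n : Fin m → ℕ) (j : Fin m) :
    ∑ k ∈ Iic j, n k = boxStart n (j + 1) := by
  rw [boxStart_succ, ← sum_Iio_eq_boxStart, ← Iio_insert, sum_insert (by simp), add_comm]

lemma mem_box_iff {m : ℕ} (n : Fin m → ℕ) (j : Fin m) (i : Fin (∑ j, n j)) :
    i ∈ box n j ↔ boxStart n j ≤ i ∧ (i : ℕ) < boxStart n (j + 1) := by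
  simp only [box, sum_Iio_eq_boxStart, sum_Iic_eq_boxStart, mem_filter, mem_univ, true_and]

lemma exists_mem_box {m : ℕ} (n : Fin m → ℕ) (i : Fin (∑ j, n j)) : ∃ j, i ∈ box n j := by
  have hex : ∃ j, (i : ℕ) < boxStart n j := ⟨m, by rw [boxStart_last]; exact i.2⟩
  have h1 := Nat.find_spec hex
  have h2 : ∀ j < Nat.find hex, boxStart n j ≤ i := fun j hj => not_lt.1 (Nat.find_min hex hj)
  have h3 : Nat.find hex ≤ m := Nat.find_min' hex (by rw [boxStart_last]; exact i.2)
  generalize Nat.find hex = j at h1 h2 h3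
  cases j with
  | zero => simp [boxStart] at h1
  | succ j => exact ⟨⟨j, h3⟩, (mem_box_iff _ _ _).2 ⟨h2 j (by omega), h1⟩⟩

lemma separated_iff_of_mem {m : ℕ} (n : Fin m → ℕ) {j : ℕ} (hj : j < m) {l : ℕ}
    (h1 : boxStart n j ≤ l) (h2 : l < boxStart n (j + 1)) (i : ℕ) :
    Separated n i l ↔ i < boxStart n j := by
  refine ⟨fun ⟨k, _, h3, h4⟩ => h3.trans_le (boxStart_mono n ?_), fun h => ⟨j, hj, h, h1⟩⟩
  by_contra hk
  have := boxStart_mono n (show j + 1 ≤ k by omega)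
  omega

lemma separated_iff {m : ℕ} (n : Fin m → ℕ) {i l : Fin (∑ j, n j)} (hil : i < l) :
    Separated n i l ↔ ∀ j, ¬ (i ∈ box n j ∧ l ∈ box n j) := by
  have hil' : (i : ℕ) < l := hil
  constructor
  · rintro h j ⟨hi, hl⟩
    rw [mem_box_iff] at hi hl
    have := (separated_iff_of_mem n j.2 hl.1 hl.2 i).1 h
    omega
  · intro h
    obtain ⟨j, hj⟩ := exists_mem_box n l
    have hj' := (mem_box_iff _ _ _).1 hj
    rw [separated_iff_of_mem n j.2 hj'.1 hj'.2]
    by_contra hc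
    exact h j ⟨(mem_box_iff _ _ _).2 ⟨by omega, by omega⟩, hj⟩

/-- The coercion of pairs of elements of `Fin N` to pairs of natural numbers. -/
def pairVal (N : ℕ) : Fin N × Fin N ↪ ℕ × ℕ := Fin.valEmbedding.prodMap Fin.valEmbedding

@[simp] lemma pairVal_apply {N : ℕ} (e : Fin N × Fin N) : pairVal N e = ((e.1 : ℕ), (e.2 : ℕ)) :=
  rfl

lemma mem_arcs {N : ℕ} {M : Finpartition (univ : Finset (Fin N))} {e : Fin N × Fin N} :
    e ∈ arcs M ↔ e.1 < e.2 ∧ {e.1, e.2} ∈ M.parts := by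
  simp [arcs]

lemma IsPerfectMatching.mem_parts_iff {N : ℕ} {M : Finpartition (univ : Finset (Fin N))}
    (hM : IsPerfectMatching M) (B : Finset (Fin N)) :
    B ∈ M.parts ↔ ∃ e ∈ arcs M, B = {e.1, e.2} := by
  constructor
  · intro hB
    obtain ⟨a, b, hab, rfl⟩ := card_eq_two.1 (hM B hB)
    rcases lt_or_gt_of_ne hab with h | h
    · exact ⟨(a, b), mem_arcs.2 ⟨h, hB⟩, rfl⟩
    · exact ⟨(b, a), mem_arcs.2 ⟨h, by rwa [pair_comm]⟩, pair_comm _ _⟩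
  · rintro ⟨e, he, rfl⟩
    exact (mem_arcs.1 he).2

lemma openCr_arcs {N : ℕ} {M : Finpartition (univ : Finset (Fin N))}
    (h : openPts N ((arcs M).map (pairVal N)) = ∅) :
    openCr N ((arcs M).map (pairVal N)) = cr M := by
  simp only [openCr, h, filter_empty, card_empty, add_zero, sum_map, filter_map, card_map, cr,
    card_filter, sum_product]
  rfl

lemma eq_of_mem_arcs {N : ℕ} {M : Finpartition (univ : Finset (Fin N))} {e f : Fin N × Fin N}
    (he : e ∈ arcs M) (hf : f ∈ arcs M) {a : Fin N} (ha : a ∈ ({e.1, e.2} : Finset (Fin N)))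
    (ha' : a ∈ ({f.1, f.2} : Finset (Fin N))) : e = f := by
  rw [mem_arcs] at he hf
  have h := M.eq_of_mem_parts he.2 hf.2 ha ha'
  have h1 : e.1 ∈ ({f.1, f.2} : Finset (Fin N)) := h ▸ by simp
  have h2 : e.2 ∈ ({f.1, f.2} : Finset (Fin N)) := h ▸ by simp
  simp only [mem_insert, mem_singleton] at h1 h2
  have h3 := he.1
  have h4 := hf.1
  ext <;> grind

lemma isPartialMatching_arcs {m : ℕ} {n : Fin m → ℕ}
    {M : Finpartition (univ : Finset (Fin (∑ j, n j)))} (hI : IsInhomogeneous n M) :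
    IsPartialMatching (Separated n) (∑ j, n j) ((arcs M).map (pairVal _)) := by
  constructor
  · intro e he
    obtain ⟨e, hea, rfl⟩ := mem_map.1 he
    have h := mem_arcs.1 hea
    refine ⟨h.1, e.2.2, (separated_iff n h.1).2 fun j => hI _ h.2 _ (by simp) _ (by simp) h.1.ne j⟩
  · intro e he f hf hef
    obtain ⟨e, hea, rfl⟩ := mem_map.1 he
    obtain ⟨f, hfa, rfl⟩ := mem_map.1 hf
    have hne : e ≠ f := fun h => hef (by rw [h])
    simp only [pairVal_apply, ne_eq, Fin.val_inj]
    refine ⟨fun h => hne ?_, fun h => hne ?_, fun h => hne ?_, fun h => hne ?_⟩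
    · exact eq_of_mem_arcs hea hfa (a := e.1) (by simp) (by simp [h])
    · exact eq_of_mem_arcs hea hfa (a := e.1) (by simp) (by simp [h])
    · exact eq_of_mem_arcs hea hfa (a := e.2) (by simp) (by simp [h])
    · exact eq_of_mem_arcs hea hfa (a := e.2) (by simp) (by simp [h])

lemma openPts_arcs {N : ℕ} {M : Finpartition (univ : Finset (Fin N))}
    (hM : IsPerfectMatching M) : openPts N ((arcs M).map (pairVal N)) = ∅ := by
  refine eq_empty_of_forall_notMem fun i hi => ?_
  obtain ⟨hiN, hi⟩ := mem_openPts.1 hi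
  obtain ⟨B, hB, hiB⟩ := M.exists_mem (mem_univ (⟨i, hiN⟩ : Fin N))
  obtain ⟨e, he, rfl⟩ := (hM.mem_parts_iff B).1 hB
  have := hi _ (mem_map_of_mem _ he)
  simp only [mem_insert, mem_singleton, Fin.ext_iff] at hiB
  simp only [pairVal_apply] at this
  omega

lemma arcs_injective {N : ℕ} {M M' : Finpartition (univ : Finset (Fin N))}
    (hM : IsPerfectMatching M) (hM' : IsPerfectMatching M') (h : arcs M = arcs M') : M = M' := by
  ext B
  rw [hM.mem_parts_iff, hM'.mem_parts_iff, h]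

/-- The absence of open points puts every point into some block, and the disjointness of arcs makes
that block unique. -/
lemma exists_arcs_eq {R : ℕ → ℕ → Prop} {N : ℕ} {A : Finset (ℕ × ℕ)}
    (hA : IsPartialMatching R N A) (hO : openPts N A = ∅) :
    ∃ M : Finpartition (univ : Finset (Fin N)), IsPerfectMatching M ∧
      (arcs M).map (pairVal N) = A := by
  set E : Finset (Fin N × Fin N) := univ.filter fun e => pairVal N e ∈ A with hE
  have hmem : ∀ e, e ∈ E ↔ pairVal N e ∈ A := fun e => by
    rw [hE, mem_filter, and_iff_right (mem_univ _)]
  have hlt : ∀ e ∈ E, e.1 < e.2 := fun e he => (hA.1 _ ((hmem e).1 he)).1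
  have hEA : E.map (pairVal N) = A := by
    ext e
    rw [mem_map]
    constructor
    · rintro ⟨f, hf, rfl⟩
      exact (hmem f).1 hf
    · intro he
      have h := hA.1 e he
      refine ⟨(⟨e.1, by omega⟩, ⟨e.2, by omega⟩), ?_, rfl⟩
      rw [hmem]
      exact he
  have huniq : ∀ e ∈ E, ∀ f ∈ E, ∀ a : Fin N, (a = e.1 ∨ a = e.2) → (a = f.1 ∨ a = f.2) →
      e = f := by
    intro e he f hf a hae haf
    by_contra hne
    have := hA.2 _ ((hmem e).1 he) _ ((hmem f).1 hf) (fun h => hne ((pairVal N).injective h))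
    simp only [pairVal_apply, ne_eq, Fin.val_inj] at this
    grind
  let M : Finpartition (univ : Finset (Fin N)) :=
    Finpartition.ofExistsUnique (E.image fun e => ({e.1, e.2} : Finset (Fin N)))
      (fun _ _ => subset_univ _) (by
        intro a _
        have ha : (a : ℕ) ∉ openPts N A := by simp [hO]
        rw [mem_openPts] at ha
        push Not at ha
        obtain ⟨e, he, hae⟩ := ha a.2
        rw [← hEA, mem_map] at he
        obtain ⟨f, hf, rfl⟩ := he
        simp only [pairVal_apply, ne_eq, Fin.val_inj] at hae
        have haf : a = f.1 ∨ a = f.2 := by tauto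
        refine ⟨{f.1, f.2}, ⟨mem_image_of_mem _ hf, by simpa using haf⟩, ?_⟩
        rintro t ⟨ht, hat⟩
        obtain ⟨g, hg, rfl⟩ := mem_image.1 ht
        rw [huniq g hg f hf a (by simpa using hat) haf])
      (by simp)
  have hparts : M.parts = E.image fun e => ({e.1, e.2} : Finset (Fin N)) := rfl
  refine ⟨M, ?_, ?_⟩
  · intro B hB
    rw [hparts] at hB
    obtain ⟨e, he, rfl⟩ := mem_image.1 hB
    exact card_pair (hlt e he).ne
  · rw [← hEA]
    congr 1
    ext1 e
    rw [mem_arcs, hparts]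
    constructor
    · rintro ⟨h1, h2⟩
      obtain ⟨f, hf, h⟩ := mem_image.1 h2
      have h3 := hlt f hf
      have h4 : e.1 ∈ ({f.1, f.2} : Finset (Fin N)) := h ▸ by simp
      have h5 : e.2 ∈ ({f.1, f.2} : Finset (Fin N)) := h ▸ by simp
      simp only [mem_insert, mem_singleton] at h4 h5
      have : e = f := by ext <;> grind
      rwa [this]
    · intro he
      exact ⟨hlt e he, mem_image_of_mem _ he⟩

lemma isInhomogeneous_of_isPartialMatching {m : ℕ} {n : Fin m → ℕ}
    {M : Finpartition (univ : Finset (Fin (∑ j, n j)))} (hM : IsPerfectMatching M)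
    (h : IsPartialMatching (Separated n) (∑ j, n j) ((arcs M).map (pairVal _))) :
    IsInhomogeneous n M := by
  intro B hB x hx y hy hxy j
  obtain ⟨e, he, rfl⟩ := (hM.mem_parts_iff B).1 hB
  have h1 := (separated_iff n (mem_arcs.1 he).1).1 (h.1 _ (mem_map_of_mem _ he)).2.2 j
  simp only [mem_insert, mem_singleton] at hx hy
  grind

/-- `K(n|q)` as a sum over the partial matchings without open points. -/
lemma K_eq_sum_partialMatchings {m : ℕ} (n : Fin m → ℕ) (q : ℝ) :
    K n q = ∑ A ∈ (partialMatchings (Separated n) (∑ j, n j)).filter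
      (fun A => openPts (∑ j, n j) A = ∅), q ^ openCr (∑ j, n j) A := by
  unfold K
  refine sum_bij (fun M _ => (arcs M).map (pairVal _)) ?_ ?_ ?_ ?_
  · intro M hM
    simp only [inhomMatchings, mem_filter, mem_univ, true_and] at hM
    exact mem_filter.2 ⟨mem_partialMatchings.2 (isPartialMatching_arcs hM.2), openPts_arcs hM.1⟩
  · intro M hM M' hM' h
    simp only [inhomMatchings, mem_filter, mem_univ, true_and] at hM hM'
    exact arcs_injective hM.1 hM'.1 (map_injective _ h)
  · intro A hA
    rw [mem_filter, mem_partialMatchings] at hA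
    obtain ⟨M, hM, rfl⟩ := exists_arcs_eq hA.1 hA.2
    refine ⟨M, ?_, rfl⟩
    simp only [inhomMatchings, mem_filter, mem_univ, true_and]
    exact ⟨hM, isInhomogeneous_of_isPartialMatching hM hA.1⟩
  · intro M hM
    simp only [inhomMatchings, mem_filter, mem_univ, true_and] at hM
    rw [openCr_arcs (openPts_arcs hM.1)]

/-! ### Expansion of the product of `q`-Hermite polynomials -/

lemma rescaledHermite_zero (q x : ℝ) : rescaledHermite q 0 x = 1 := by
  simp [rescaledHermite, contHermite]

lemma rescaledHermite_succ {q : ℝ} (hq : q < 1) (n : ℕ) (x : ℝ) :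
    rescaledHermite q (n + 1) x =
      x * rescaledHermite q n x - qInt q n * rescaledHermite q (n - 1) x := by
  have hpos : 0 < √(1 - q) := Real.sqrt_pos.2 (by linarith)
  have hsq : √(1 - q) ^ 2 = 1 - q := Real.sq_sqrt (by linarith)
  cases n with
  -- Here `n - 1` truncates to 0, but its coefficient `[0]` vanishes.
  | zero =>
    simp only [rescaledHermite, contHermite, qInt_zero]
    simp
    field_simp
  | succ n =>
    have h1 := one_sub_mul_qInt q (n + 1)
    simp only [rescaledHermite, contHermite, Nat.add_sub_cancel, Polynomial.eval_sub,
      Polynomial.eval_mul, Polynomial.eval_C, Polynomial.eval_X, Polynomial.eval_ofNat]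
    rw [← h1]
    generalize √(1 - q) = a at hpos hsq ⊢
    rw [← hsq]
    field_simp
    ring

/-- The expansion of a product of `q`-Hermite polynomials in terms of partial matchings. -/
lemma prod_rescaledHermite {q : ℝ} (hq : q < 1) {m : ℕ} (n : Fin m → ℕ) (x : ℝ) :
    ∏ j, rescaledHermite q (n j) x =
      ∑ A ∈ partialMatchings (Separated n) (∑ j, n j), q ^ openCr (∑ j, n j) A *
        rescaledHermite q (openPts (∑ j, n j) A).card x := by
  have := prod_eq_sum_partialMatchings (η := fun k => rescaledHermite q k x)
    (rescaledHermite_zero q x) (fun k => rescaledHermite_succ hq k x) (R := Separated n)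
    (boxStart n) (fun i => if h : i < m then n ⟨i, h⟩ else 0) (by simp [boxStart]) m
    (fun j _ => by simp [boxStart, sum_range_succ])
    (fun j hj l h1 h2 i => separated_iff_of_mem n hj h1 h2 i)
  rw [boxStart_last, prod_range] at this
  rw [← this]
  simp

end QHermite

namespace QHermite

/-! ### Gaussian binomials and Rogers–Szegő polynomials -/

open Finset Polynomial Filter Topology

/-- The finite `q`-shifted factorial `(q; q)_n`. -/
noncomputable def qPoch (q : ℝ) (n : ℕ) : ℝ := ∏ k ∈ range n, (1 - q ^ (k + 1))

lemma qPoch_succ (q : ℝ) (n : ℕ) : qPoch q (n + 1) = qPoch q n * (1 - q ^ (n + 1)) :=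
  prod_range_succ _ _

@[simp] lemma qPoch_zero (q : ℝ) : qPoch q 0 = 1 := by simp [qPoch]

lemma one_sub_pow_pos {q : ℝ} (hq : |q| < 1) (k : ℕ) : 0 < 1 - q ^ (k + 1) := by
  have h1 : |q ^ (k + 1)| < 1 := by
    rw [abs_pow]
    exact pow_lt_one₀ (abs_nonneg q) hq (by omega)
  linarith [le_abs_self (q ^ (k + 1))]

lemma qPoch_pos {q : ℝ} (hq : |q| < 1) (n : ℕ) : 0 < qPoch q n :=
  prod_pos fun k _ => one_sub_pow_pos hq k

/-- The Gaussian binomial coefficients. -/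
noncomputable def gaussBinom (q : ℝ) : ℕ → ℕ → ℝ
  | _, 0 => 1
  | 0, _ + 1 => 0
  | n + 1, k + 1 => gaussBinom q n k + q ^ (k + 1) * gaussBinom q n (k + 1)

@[simp] lemma gaussBinom_zero_right (q : ℝ) (n : ℕ) : gaussBinom q n 0 = 1 := by
  cases n <;> rfl

lemma gaussBinom_succ_succ (q : ℝ) (n k : ℕ) :
    gaussBinom q (n + 1) (k + 1) = gaussBinom q n k + q ^ (k + 1) * gaussBinom q n (k + 1) := rfl

lemma gaussBinom_eq_zero (q : ℝ) {n k : ℕ} (h : n < k) : gaussBinom q n k = 0 := by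
  induction n generalizing k with
  | zero => cases k with
    | zero => omega
    | succ k => rfl
  | succ n ih => cases k with
    | zero => omega
    | succ k => rw [gaussBinom_succ_succ, ih (by omega), ih (by omega)]; ring

@[simp] lemma gaussBinom_self (q : ℝ) (n : ℕ) : gaussBinom q n n = 1 := by
  induction n with
  | zero => rfl
  | succ n ih => rw [gaussBinom_succ_succ, ih, gaussBinom_eq_zero q (by omega)]; ring

lemma gaussBinom_add_mul (q : ℝ) (k j : ℕ) :
    gaussBinom q (k + j) k * (qPoch q k * qPoch q j) = qPoch q (k + j) := by
  induction k generalizing j with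
  | zero => simp
  | succ k ihk =>
    induction j with
    | zero => simp
    | succ j ihj =>
      have h1 := ihk (j + 1)
      rw [show k + 1 + (j + 1) = k + (j + 1) + 1 by ring, gaussBinom_succ_succ]
      rw [show k + 1 + j = k + (j + 1) by ring] at ihj
      rw [qPoch_succ q (k + (j + 1)), qPoch_succ q j] at *
      rw [qPoch_succ q k] at *
      -- The Pascal rule combines with `1 - q^(a+b) = (1 - q^a) + q^a (1 - q^b)` for `a = k + 1`, `b
      -- = j + 1`.
      linear_combination (1 - q ^ (k + 1)) * h1 + q ^ (k + 1) * (1 - q ^ (j + 1)) * ihj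

lemma gaussBinom_eq_div {q : ℝ} (hq : |q| < 1) {n k : ℕ} (h : k ≤ n) :
    gaussBinom q n k = qPoch q n / (qPoch q k * qPoch q (n - k)) := by
  obtain ⟨j, rfl⟩ := Nat.exists_eq_add_of_le h
  rw [Nat.add_sub_cancel_left, eq_div_iff (mul_pos (qPoch_pos hq _) (qPoch_pos hq _)).ne',
    gaussBinom_add_mul]

lemma gaussBinom_symm {q : ℝ} (hq : |q| < 1) {n k : ℕ} (h : k ≤ n) :
    gaussBinom q n (n - k) = gaussBinom q n k := by
  rw [gaussBinom_eq_div hq h, gaussBinom_eq_div hq (Nat.sub_le _ _), Nat.sub_sub_self h, mul_comm]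

/-- The mirror image of the defining Pascal rule under `k ↦ n - k`. -/
lemma gaussBinom_succ_succ' {q : ℝ} (hq : |q| < 1) {n k : ℕ} (h : k ≤ n) :
    gaussBinom q (n + 1) (k + 1) = gaussBinom q n (k + 1) + q ^ (n - k) * gaussBinom q n k := by
  rcases h.eq_or_lt with rfl | h
  · rw [gaussBinom_eq_zero q (Nat.lt_succ_self k)]
    simp
  · obtain ⟨j, rfl⟩ := Nat.exists_eq_add_of_lt h
    have h1 := gaussBinom_symm hq (show k + 1 ≤ k + j + 1 + 1 by omega)
    have h2 := gaussBinom_symm hq (show k + 1 ≤ k + j + 1 by omega)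
    have h3 := gaussBinom_symm hq (show k ≤ k + j + 1 by omega)
    rw [show k + j + 1 + 1 - (k + 1) = j + 1 by omega] at h1
    rw [show k + j + 1 - (k + 1) = j by omega] at h2
    rw [show k + j + 1 - k = j + 1 by omega] at h3 ⊢
    rw [← h1, ← h2, ← h3, gaussBinom_succ_succ]

/-- This is what the Rogers–Szegő recurrence requires of its coefficients once the Pascal rule is
subtracted. -/
lemma one_sub_pow_mul_gaussBinom {q : ℝ} (hq : |q| < 1) (n k : ℕ) :
    (1 - q ^ (k + 1)) * gaussBinom q (n + 1) (k + 1) = (1 - q ^ (n + 1)) * gaussBinom q n k := by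
  rcases le_or_gt k n with h | h
  · obtain ⟨j, rfl⟩ := Nat.exists_eq_add_of_le h
    have h1 := gaussBinom_add_mul q k j
    have h2 := gaussBinom_add_mul q (k + 1) j
    rw [show k + 1 + j = k + j + 1 by ring, qPoch_succ, qPoch_succ] at h2
    have h3 : qPoch q k * qPoch q j ≠ 0 := (mul_pos (qPoch_pos hq _) (qPoch_pos hq _)).ne'
    refine mul_right_cancel₀ h3 ?_
    linear_combination h2 - (1 - q ^ (k + j + 1)) * h1
  · rw [gaussBinom_eq_zero q h, gaussBinom_eq_zero q (by omega)]
    simp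

/-- The Rogers–Szegő polynomials. -/
noncomputable def rogersSzego (q : ℝ) : ℕ → ℝ[X]
  | 0 => 1
  | 1 => 1 + X
  | n + 2 => (1 + X) * rogersSzego q (n + 1) - C (1 - q ^ (n + 1)) * X * rogersSzego q n

lemma coeff_rogersSzego {q : ℝ} (hq : |q| < 1) (n k : ℕ) :
    (rogersSzego q n).coeff k = gaussBinom q n k := by
  induction n using Nat.twoStepInduction generalizing k with
  | zero => cases k with
    | zero => simp [rogersSzego]
    | succ k => simp [rogersSzego, gaussBinom, coeff_one]
  | one => rcases k with _ | _ | k <;> simp [rogersSzego, gaussBinom, coeff_one, coeff_X]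
  | more n ih1 ih2 =>
    rw [rogersSzego, coeff_sub, add_mul, one_mul, coeff_add, mul_assoc, coeff_C_mul]
    cases k with
    | zero => simp [ih2]
    | succ k =>
      rw [coeff_X_mul, coeff_X_mul, ih1, ih2, ih2, gaussBinom_succ_succ q (n + 1)]
      linear_combination one_sub_pow_mul_gaussBinom hq n k

/-- Since `u * (u + v) = 1 + u ^ 2`, multiplication by powers of `u` turns one recurrence into the
other. With `u = e^{iθ}`, a polynomial in `cos θ` becomes one in `e^{2iθ}`. -/
lemma aeval_rogersSzego (q : ℝ) (n : ℕ) {u v : ℂ} (huv : u * v = 1) :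
    aeval (u ^ 2) (rogersSzego q n) = u ^ n * aeval ((u + v) / 2) (contHermite q n) := by
  induction n using Nat.twoStepInduction with
  | zero => simp [rogersSzego, contHermite]
  | one =>
    simp only [rogersSzego, contHermite, map_add, map_mul, map_one, aeval_X, map_ofNat]
    linear_combination -huv
  | more n ih1 ih2 =>
    simp only [rogersSzego, contHermite, map_add, map_mul, map_one, aeval_X, map_ofNat, map_sub,
      ih1, ih2, aeval_C]
    linear_combination (-u ^ (n + 1) * aeval ((u + v) / 2) (contHermite q (n + 1))) * huv

/-! ### The finite Jacobi triple product and its limit -/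

/-- The triangular numbers `j (j - 1) / 2`, `j ∈ ℤ`. -/
def tri (j : ℤ) : ℕ := (j * (j - 1) / 2).toNat

lemma two_mul_tri (j : ℤ) : 2 * (tri j : ℤ) = j * (j - 1) := by
  have h1 : 0 ≤ j * (j - 1) := by
    rcases le_or_gt j 0 with h | h
    · nlinarith
    · nlinarith
  have h2 : (2 : ℤ) ∣ j * (j - 1) := by
    have := Int.even_mul_succ_self (j - 1)
    rw [sub_add_cancel, mul_comm] at this
    exact this.two_dvd
  rw [tri, Int.toNat_of_nonneg (by omega)]
  omega

lemma tri_one_sub (j : ℤ) : tri (1 - j) = tri j := by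
  have h1 := two_mul_tri j
  have h2 := two_mul_tri (1 - j)
  have : (1 - j) * (1 - j - 1) = j * (j - 1) := by ring
  omega

lemma tri_add_one (j : ℤ) : (tri (j + 1) : ℤ) = tri j + j := by
  have h1 := two_mul_tri j
  have h2 := two_mul_tri (j + 1)
  have : (j + 1) * (j + 1 - 1) = j * (j - 1) + 2 * j := by ring
  omega

/-- The finite theta product, as a polynomial. -/
noncomputable def thetaPoly (q : ℝ) (M N : ℕ) : ℝ[X] :=
  (∏ k ∈ range M, (1 - C (q ^ k) * X)) * ∏ k ∈ range N, (X - C (q ^ (k + 1)))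

/-- The finite form of the Jacobi triple product identity. -/
lemma coeff_thetaPoly {q : ℝ} (hq : |q| < 1) (M N i : ℕ) :
    (thetaPoly q M N).coeff i =
      gaussBinom q (M + N) i * (-1) ^ (i + N) * q ^ tri (i - N) := by
  induction M generalizing i with
  | zero =>
    -- The factor `X - q^(N+1)` corresponds to the defining Pascal rule; in the outer induction, `1
    -- - q^M X` corresponds to its mirror image.
    induction N generalizing i with
    | zero =>
      cases i with
      | zero => simp [thetaPoly, tri]
      | succ i => simp [thetaPoly, coeff_one, gaussBinom]
    | succ N ih =>
      have hstep : thetaPoly q 0 (N + 1) = X * thetaPoly q 0 N -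
          C (q ^ (N + 1)) * thetaPoly q 0 N := by
        simp only [thetaPoly, prod_range_succ]
        ring
      simp only [zero_add] at ih ⊢
      rw [hstep, coeff_sub, coeff_C_mul, ih]
      cases i with
      | zero =>
        have h1 : tri ((0 : ℕ) - (N + 1 : ℕ)) = tri ((0 : ℕ) - (N : ℕ)) + (N + 1) := by
          have := tri_add_one (-(N + 1 : ℤ))
          rw [show -(N + 1 : ℤ) + 1 = -N by ring] at this
          push_cast
          rw [zero_sub, zero_sub]
          omega
        rw [h1]
        simp
        ring
      | succ i =>
        rw [coeff_X_mul, ih, gaussBinom_succ_succ]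
        have h1 : tri ((i + 1 : ℕ) - (N + 1 : ℕ)) = tri (i - N) := by
          congr 1
          push_cast
          ring
        have h2 : N + 1 + tri ((i + 1 : ℕ) - N) = i + 1 + tri (i - N) := by
          have := tri_add_one (i - N)
          rw [show (i : ℤ) - N + 1 = (i + 1 : ℕ) - N by push_cast; ring] at this
          omega
        have h3 : q ^ (N + 1) * q ^ tri ((i + 1 : ℕ) - N) = q ^ (i + 1) * q ^ tri (i - N) := by
          rw [← pow_add, h2, pow_add]
        rw [h1]
        linear_combination -gaussBinom q N (i + 1) * (-1) ^ (i + 1 + N) * h3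
  | succ M ih =>
    have hstep : thetaPoly q (M + 1) N = thetaPoly q M N -
        C (q ^ M) * (X * thetaPoly q M N) := by
      simp only [thetaPoly, prod_range_succ]
      ring
    rw [hstep, coeff_sub, coeff_C_mul, ih]
    cases i with
    | zero => simp
    | succ i =>
      rw [coeff_X_mul, ih, show M + 1 + N = M + N + 1 by ring]
      rcases le_or_gt i (M + N) with hi | hi
      · rw [gaussBinom_succ_succ' hq hi]
        have h2 : M + tri (i - N) = M + N - i + tri ((i + 1 : ℕ) - N) := by
          have := tri_add_one (i - N)
          rw [show (i : ℤ) - N + 1 = (i + 1 : ℕ) - N by push_cast; ring] at this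
          omega
        have h3 : q ^ M * q ^ tri (i - N) = q ^ (M + N - i) * q ^ tri ((i + 1 : ℕ) - N) := by
          rw [← pow_add, h2, pow_add]
        linear_combination -gaussBinom q (M + N) i * (-1) ^ (i + N) * h3
      · rw [gaussBinom_eq_zero q hi, gaussBinom_eq_zero q (show M + N < i + 1 by omega),
          gaussBinom_eq_zero q (show M + N + 1 < i + 1 by omega)]
        simp

/-- The sum of the coefficients of `thetaPoly q r r` is its value at 1, where the factor `1 - q^0 X`
vanishes as soon as `r > 0`. -/
lemma sum_gaussBinom_tri {q : ℝ} (hq : |q| < 1) (r : ℕ) :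
    ∑ k ∈ range (2 * r + 1), gaussBinom q (2 * r) k * ((-1) ^ (k + r) * q ^ tri (k - r)) =
      if r = 0 then 1 else 0 := by
  have hdeg : (thetaPoly q r r).natDegree < 2 * r + 1 := by
    rw [Nat.lt_succ_iff, natDegree_le_iff_coeff_eq_zero]
    intro i hi
    rw [coeff_thetaPoly hq, gaussBinom_eq_zero q (by omega)]
    simp
  have h := eval_eq_sum_range' hdeg 1
  simp only [one_pow, mul_one, coeff_thetaPoly hq, ← two_mul, mul_assoc] at h
  rw [← h]
  split_ifs with hr
  · simp [hr, thetaPoly]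
  · obtain ⟨s, rfl⟩ := Nat.exists_eq_succ_of_ne_zero hr
    simp [thetaPoly, prod_range_succ', eval_mul]

lemma sum_gaussBinom_tri' {q : ℝ} (hq : |q| < 1) (r : ℕ) :
    ∑ k ∈ range (2 * r + 1), gaussBinom q (2 * r) k * ((-1) ^ (k + r) * q ^ tri (r - k)) =
      if r = 0 then 1 else 0 := by
  rw [← sum_gaussBinom_tri hq r, ← sum_range_reflect]
  refine sum_congr rfl fun k hk => ?_
  have hk := mem_range.1 hk
  rw [show 2 * r + 1 - 1 - k = 2 * r - k by omega, gaussBinom_symm hq (by omega)]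
  have h1 : (r : ℤ) - (2 * r - k : ℕ) = k - r := by omega
  have h2 : ((-1) ^ (2 * r - k + r) : ℝ) = (-1) ^ (k + r) := by
    rw [neg_one_pow_eq_pow_mod_two, neg_one_pow_eq_pow_mod_two (n := k + r)]
    congr 1
    omega
  rw [h1, h2]

/-- The assumption `r ≤ N` gives `k ≤ N + r` for all `k ≤ 2 * r`, so no subtraction truncates. -/
lemma coeff_thetaPoly_mul {q : ℝ} (hq : |q| < 1) {N r : ℕ} (h : r ≤ N) :
    (rogersSzego q (2 * r) * (thetaPoly q N N * (X - 1))).coeff (N + r + 1) =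
      ∑ k ∈ range (2 * r + 1), gaussBinom q (2 * r) k *
        ((thetaPoly q N N).coeff (N + r - k) - (thetaPoly q N N).coeff (N + (r + 1) - k)) := by
  rw [coeff_mul, Nat.sum_antidiagonal_eq_sum_range_succ_mk]
  symm
  refine sum_subset_zero_on_sdiff (range_subset_range.2 (by omega)) ?_ ?_
  · intro k hk
    simp only [Finset.mem_sdiff, mem_range] at hk
    rw [coeff_rogersSzego hq, gaussBinom_eq_zero q (by omega), zero_mul]
  · intro k hk
    have hk := mem_range.1 hk
    rw [coeff_rogersSzego hq, show N + r + 1 - k = (N + r - k) + 1 by omega,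
      show N + (r + 1) - k = (N + r - k) + 1 by omega, mul_sub (thetaPoly q N N), coeff_sub,
      coeff_mul_X, mul_one]

/-- Near the centre, numerator and both denominator factors tend to `P`, whence `P / (P * P)`. -/
lemma tendsto_gaussBinom_center {q P : ℝ} (hq : |q| < 1) (hP : P ≠ 0)
    (h : Tendsto (qPoch q) atTop (𝓝 P)) (a b : ℕ) :
    Tendsto (fun N => gaussBinom q (N + N) (N + a - b)) atTop (𝓝 P⁻¹) := by
  have h1 : Tendsto (fun N => qPoch q (N + N) / (qPoch q (N + a - b) * qPoch q (N + b - a))) atTop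
      (𝓝 (P / (P * P))) := by
    refine Tendsto.div ?_ (Tendsto.mul ?_ ?_) (mul_ne_zero hP hP) <;> refine h.comp ?_
    · exact tendsto_atTop_mono (fun N => Nat.le_add_left N N) tendsto_id
    · exact tendsto_atTop_mono (f := fun N => N - b) (fun N => by omega) (tendsto_sub_atTop_nat b)
    · exact tendsto_atTop_mono (f := fun N => N - a) (fun N => by omega) (tendsto_sub_atTop_nat a)
  rw [show P / (P * P) = P⁻¹ by field_simp] at h1
  refine h1.congr' ?_
  filter_upwards [eventually_ge_atTop (a + b)] with N hN
  rw [gaussBinom_eq_div hq (by omega), show N + N - (N + a - b) = N + b - a by omega]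

lemma tendsto_coeff_thetaPoly {q P : ℝ} (hq : |q| < 1) (hP : P ≠ 0)
    (h : Tendsto (qPoch q) atTop (𝓝 P)) (a b : ℕ) :
    Tendsto (fun N => (thetaPoly q N N).coeff (N + a - b)) atTop
      (𝓝 (P⁻¹ * ((-1) ^ (b + a) * q ^ tri (a - b)))) := by
  refine ((tendsto_gaussBinom_center hq hP h a b).mul_const _).congr' ?_
  filter_upwards [eventually_ge_atTop (a + b)] with N hN
  have h2 : ((-1) ^ (N + a - b + N) : ℝ) = (-1) ^ (b + a) := by
    rw [neg_one_pow_eq_pow_mod_two, neg_one_pow_eq_pow_mod_two (n := b + a)]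
    congr 1
    omega
  have h3 : ((N + a - b : ℕ) : ℤ) - N = a - b := by omega
  rw [coeff_thetaPoly hq, h2, h3, mul_assoc]

/-- The limit of the constant terms that represent the integral of `H_{2r}` against the weight. -/
lemma tendsto_coeff_thetaPoly_mul {q P : ℝ} (hq : |q| < 1) (hP : P ≠ 0)
    (h : Tendsto (qPoch q) atTop (𝓝 P)) (r : ℕ) :
    Tendsto (fun N => (rogersSzego q (2 * r) * (thetaPoly q N N * (X - 1))).coeff (N + r + 1))
      atTop (𝓝 (P⁻¹ * if r = 0 then 2 else 0)) := by
  have h1 : Tendsto (fun N => ∑ k ∈ range (2 * r + 1), gaussBinom q (2 * r) k *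
      ((thetaPoly q N N).coeff (N + r - k) - (thetaPoly q N N).coeff (N + (r + 1) - k))) atTop
      (𝓝 (∑ k ∈ range (2 * r + 1), gaussBinom q (2 * r) k *
        (P⁻¹ * ((-1) ^ (k + r) * q ^ tri (r - k)) -
          P⁻¹ * ((-1) ^ (k + (r + 1)) * q ^ tri ((r + 1 : ℕ) - k))))) :=
    tendsto_finsetSum _ fun k _ => ((tendsto_coeff_thetaPoly hq hP h r k).sub
      (tendsto_coeff_thetaPoly hq hP h (r + 1) k)).const_mul _
  have h2 : ∑ k ∈ range (2 * r + 1), gaussBinom q (2 * r) k *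
        (P⁻¹ * ((-1) ^ (k + r) * q ^ tri (r - k)) -
          P⁻¹ * ((-1) ^ (k + (r + 1)) * q ^ tri ((r + 1 : ℕ) - k))) =
      P⁻¹ * if r = 0 then 2 else 0 := by
    have h3 : P⁻¹ * (if r = 0 then 2 else 0) = P⁻¹ * (if r = 0 then 1 else 0) +
        P⁻¹ * (if r = 0 then 1 else 0) := by split_ifs <;> ring
    rw [h3]
    nth_rw 1 [← sum_gaussBinom_tri' hq r]
    rw [← sum_gaussBinom_tri hq r, mul_sum, mul_sum, ← sum_add_distrib]
    refine sum_congr rfl fun k _ => ?_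
    -- The symmetry `tri (1 - j) = tri j` and the opposite sign turn the subtracted sum into a
    -- second vanishing theta sum; for `r = 0` the two add up to 2.
    rw [show ((r + 1 : ℕ) : ℤ) - k = 1 - (k - r) by push_cast; ring, tri_one_sub]
    ring
  rw [h2] at h1
  refine h1.congr' ?_
  filter_upwards [eventually_ge_atTop r] with N hN
  rw [coeff_thetaPoly_mul hq hN]

end QHermite

namespace QHermite

/-! ### Convergence and bounds for the infinite products -/

open Finset Polynomial Filter Topology

lemma summable_abs_pow {q : ℝ} (hq : |q| < 1) : Summable fun k : ℕ => |q| ^ k :=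
  summable_geometric_of_lt_one (abs_nonneg q) hq

lemma summable_norm_neg_pow_succ {q : ℝ} (hq : |q| < 1) :
    Summable fun k : ℕ => ‖-q ^ (k + 1)‖ := by
  simp only [norm_neg, norm_pow, Real.norm_eq_abs]
  exact (summable_nat_add_iff 1).2 (summable_abs_pow hq)

lemma tendsto_qPoch {q : ℝ} (hq : |q| < 1) : Tendsto (qPoch q) atTop (𝓝 (qPochInfty q)) := by
  have h := (multipliable_one_add_of_summable (summable_norm_neg_pow_succ hq)).hasProd
  simp only [← sub_eq_add_neg] at h
  exact h.tendsto_prod_nat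

lemma qPochInfty_ne_zero {q : ℝ} (hq : |q| < 1) : qPochInfty q ≠ 0 := by
  have h := tprod_one_add_ne_zero_of_summable (f := fun k : ℕ => -q ^ (k + 1))
    (fun k => by rw [← sub_eq_add_neg]; exact (one_sub_pow_pos hq k).ne')
    (summable_norm_neg_pow_succ hq)
  simp only [← sub_eq_add_neg] at h
  exact h

/-- The `k`-th factor `(1 - q^k e^{2iθ}) (1 - q^k e^{-2iθ})` of the weight at `cos θ`. -/
noncomputable def weightFactor (q θ : ℝ) (k : ℕ) : ℝ :=
  1 + (2 - 4 * Real.cos θ ^ 2) * q ^ k + q ^ (2 * k)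

/-- The infinite product in the weight, in terms of the angle. -/
noncomputable def weightProd (q θ : ℝ) : ℝ := ∏' k, weightFactor q θ k

lemma abs_two_sub_four_mul_cos_sq_le (θ : ℝ) : |2 - 4 * Real.cos θ ^ 2| ≤ 2 := by
  rw [abs_le]
  constructor <;>
    nlinarith [Real.sin_sq_add_cos_sq θ, sq_nonneg (Real.sin θ), sq_nonneg (Real.cos θ)]

lemma tendsto_prod_weightFactor {q : ℝ} (hq : |q| < 1) (θ : ℝ) :
    Tendsto (fun N => ∏ k ∈ range N, weightFactor q θ k) atTop (𝓝 (weightProd q θ)) := by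
  have hs : Summable fun k : ℕ => ‖(2 - 4 * Real.cos θ ^ 2) * q ^ k + q ^ (2 * k)‖ := by
    refine Summable.of_nonneg_of_le (fun k => norm_nonneg _) (fun k => ?_)
      ((summable_abs_pow hq).mul_left 3)
    have h1 : |q| ^ (2 * k) ≤ |q| ^ k := pow_le_pow_of_le_one (abs_nonneg q) hq.le (by omega)
    have h2 : 0 ≤ |q| ^ k := by positivity
    calc _ ≤ ‖(2 - 4 * Real.cos θ ^ 2) * q ^ k‖ + ‖q ^ (2 * k)‖ := norm_add_le _ _
      _ = |2 - 4 * Real.cos θ ^ 2| * |q| ^ k + |q| ^ (2 * k) := by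
        simp only [Real.norm_eq_abs, abs_mul, abs_pow]
      _ ≤ 3 * |q| ^ k := by
        nlinarith [mul_le_mul_of_nonneg_right (abs_two_sub_four_mul_cos_sq_le θ) h2]
  have h := (multipliable_one_add_of_summable hs).hasProd
  simp only [← add_assoc] at h
  exact h.tendsto_prod_nat

/-- Each factor is at most `(1 + |q|^k)^2 ≤ exp (2 |q|^k)`. The bound is uniform in `N` and `θ`, as
dominated convergence needs. -/
lemma abs_prod_weightFactor_le {q : ℝ} (hq : |q| < 1) (θ : ℝ) (N : ℕ) :
    |∏ k ∈ range N, weightFactor q θ k| ≤ Real.exp (∑' k, 2 * |q| ^ k) := by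
  rw [abs_prod]
  calc _ ≤ ∏ k ∈ range N, Real.exp (2 * |q| ^ k) := by
        refine prod_le_prod (fun k _ => abs_nonneg _) fun k _ => ?_
        have h2 : 0 ≤ |q| ^ k := by positivity
        calc _ ≤ |1 + (2 - 4 * Real.cos θ ^ 2) * q ^ k| + |q ^ (2 * k)| := abs_add_le _ _
          _ ≤ |1| + |(2 - 4 * Real.cos θ ^ 2) * q ^ k| + |q ^ (2 * k)| := by
            gcongr
            exact abs_add_le _ _
          _ = 1 + |2 - 4 * Real.cos θ ^ 2| * |q| ^ k + (|q| ^ k) ^ 2 := by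
            rw [abs_one, abs_mul, abs_pow, abs_pow, ← pow_mul, mul_comm k]
          _ ≤ (1 + |q| ^ k) ^ 2 := by
            nlinarith [mul_le_mul_of_nonneg_right (abs_two_sub_four_mul_cos_sq_le θ) h2]
          _ ≤ Real.exp (|q| ^ k) ^ 2 := by
            gcongr
            linarith [Real.add_one_le_exp (|q| ^ k)]
          _ = Real.exp (2 * |q| ^ k) := by
            rw [← Real.exp_nat_mul]
            norm_num
    _ = Real.exp (∑ k ∈ range N, 2 * |q| ^ k) := (Real.exp_sum _ _).symm
    _ ≤ _ := by
      gcongr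
      exact ((summable_abs_pow hq).mul_left 2).sum_le_tsum _ fun k _ => by positivity

lemma abs_weightProd_le {q : ℝ} (hq : |q| < 1) (θ : ℝ) :
    |weightProd q θ| ≤ Real.exp (∑' k, 2 * |q| ^ k) :=
  le_of_tendsto (tendsto_prod_weightFactor hq θ).abs
    (Eventually.of_forall fun N => abs_prod_weightFactor_le hq θ N)

lemma measurable_weightProd {q : ℝ} (hq : |q| < 1) : Measurable (weightProd q) := by
  refine measurable_of_tendsto_metrizable (f := fun N θ => ∏ k ∈ range N, weightFactor q θ k)
    (fun N => ?_) (tendsto_pi_nhds.2 fun θ => tendsto_prod_weightFactor hq θ)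
  unfold weightFactor
  fun_prop

/-! ### The integral as a coefficient on the circle -/

lemma exp_mul_I_add_exp_neg (θ : ℝ) :
    (Complex.exp (θ * Complex.I) + Complex.exp (-(θ * Complex.I))) / 2 = (Real.cos θ : ℂ) := by
  rw [Complex.ofReal_cos, Complex.cos, neg_mul]

lemma ofReal_weightFactor (q θ : ℝ) (k : ℕ) {u v : ℂ} (hu : u = Complex.exp (θ * Complex.I))
    (hv : v = Complex.exp (-(θ * Complex.I))) :
    (weightFactor q θ k : ℂ) = (1 - q ^ k * u ^ 2) * (1 - q ^ k * v ^ 2) := by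
  have huv : u * v = 1 := by rw [hu, hv, ← Complex.exp_add]; simp
  have hc : (u + v) / 2 = (Real.cos θ : ℂ) := by rw [hu, hv]; exact exp_mul_I_add_exp_neg θ
  unfold weightFactor
  push_cast at hc ⊢
  rw [← hc, mul_comm 2 k, pow_mul]
  linear_combination (-2 * (q : ℂ) ^ k - (q ^ k) ^ 2 * (u * v + 1)) * huv

/-- The finite theta product times `1 - e^{-2iθ}`, in terms of the factors of the weight. -/
lemma aeval_thetaPoly (q θ : ℝ) (N : ℕ) {u v : ℂ} (hu : u = Complex.exp (θ * Complex.I))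
    (hv : v = Complex.exp (-(θ * Complex.I))) :
    aeval (u ^ 2) (thetaPoly q N N * (X - 1)) * v ^ (2 * (N + 1)) =
      ((∏ k ∈ range N, weightFactor q θ k : ℝ) : ℂ) * (1 - q ^ N * v ^ 2) := by
  have huv : u * v = 1 := by rw [hu, hv, ← Complex.exp_add]; simp
  have huv2 : u ^ 2 * v ^ 2 = 1 := by rw [← mul_pow, huv, one_pow]
  have h1 : (u ^ 2 - 1) * v ^ 2 = 1 - v ^ 2 := by linear_combination huv2
  have h2 : aeval (u ^ 2) (thetaPoly q N N) * (v ^ 2) ^ N =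
      (∏ k ∈ range N, (1 - q ^ k * u ^ 2)) * ∏ k ∈ range N, (1 - q ^ (k + 1) * v ^ 2) := by
    simp only [thetaPoly, map_mul, map_prod, map_sub, map_one, aeval_X, map_pow, aeval_C,
      Complex.coe_algebraMap]
    rw [mul_assoc, ← card_range N, ← prod_const, card_range, ← prod_mul_distrib]
    congr 1
    refine prod_congr rfl fun k _ => ?_
    linear_combination huv2
  rw [Complex.ofReal_prod, map_mul, pow_mul, pow_succ]
  simp only [ofReal_weightFactor q θ _ hu hv, map_sub, aeval_X, map_one, prod_mul_distrib]
  -- Splitting one product over `N + 1` factors at either end trades `1 - v^2` for `1 - q^N v^2`,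
  -- which tends to 1.
  have h3 := prod_range_succ (fun k => 1 - (q : ℂ) ^ k * v ^ 2) N
  rw [prod_range_succ'] at h3
  simp only [pow_zero, one_mul] at h3
  calc _ = aeval (u ^ 2) (thetaPoly q N N) * (v ^ 2) ^ N * ((u ^ 2 - 1) * v ^ 2) :=
        mul_mul_mul_comm _ _ _ _
    _ = (∏ k ∈ range N, (1 - (q : ℂ) ^ k * u ^ 2)) *
        ((∏ k ∈ range N, (1 - (q : ℂ) ^ (k + 1) * v ^ 2)) * (1 - v ^ 2)) := by
      rw [h2, h1, mul_assoc]
    _ = _ := by rw [h3]; ring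

/-- Only even powers of `e^{iθ}` occur, so `[0, π]` is a full period. -/
lemma integral_exp_pow_mul (k l : ℕ) :
    ∫ θ in (0 : ℝ)..Real.pi, (Complex.exp (θ * Complex.I) ^ 2) ^ k *
      Complex.exp (-(θ * Complex.I)) ^ (2 * l) = if k = l then (Real.pi : ℂ) else 0 := by
  have h : ∀ θ : ℝ, (Complex.exp (θ * Complex.I) ^ 2) ^ k *
      Complex.exp (-(θ * Complex.I)) ^ (2 * l) =
      Complex.exp ((((k : ℤ) - l : ℤ) : ℂ) * (2 * Complex.I) * θ) := by
    intro θ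
    rw [← pow_mul, ← Complex.exp_nat_mul, ← Complex.exp_nat_mul, ← Complex.exp_add]
    congr 1
    push_cast
    ring
  simp only [h]
  split_ifs with hkl
  · simp [hkl]
  · have hne : (((k : ℤ) - l : ℤ) : ℂ) ≠ 0 := by
      rw [Int.cast_ne_zero]
      omega
    rw [integral_exp_mul_complex (mul_ne_zero hne (by simp)),
      show (((k : ℤ) - l : ℤ) : ℂ) * (2 * Complex.I) * (Real.pi : ℂ) =
        (((k : ℤ) - l : ℤ) : ℂ) * (2 * Real.pi * Complex.I) by ring,
      Complex.exp_int_mul_two_pi_mul_I]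
    simp

/-- The integral over the circle extracts a coefficient of a polynomial. -/
lemma integral_aeval_mul (p : ℝ[X]) (l : ℕ) :
    ∫ θ in (0 : ℝ)..Real.pi, aeval (Complex.exp (θ * Complex.I) ^ 2) p *
      Complex.exp (-(θ * Complex.I)) ^ (2 * l) = Real.pi * (p.coeff l : ℂ) := by
  simp only [aeval_eq_sum_range, sum_mul, Algebra.smul_def, Complex.coe_algebraMap, mul_assoc]
  rw [intervalIntegral.integral_finsetSum]
  · simp only [intervalIntegral.integral_const_mul, integral_exp_pow_mul, mul_ite, mul_zero]
    rw [sum_ite_eq']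
    split_ifs with h
    · ring
    · rw [coeff_eq_zero_of_natDegree_lt (by simpa using h)]
      simp
  · intro k _
    apply Continuous.intervalIntegrable
    fun_prop

/-- The integral of the even `q`-Hermite polynomials. -/
lemma integral_weightProd_mul_contHermite_even {q : ℝ} (hq : |q| < 1) (r : ℕ) :
    ∫ θ in (0 : ℝ)..Real.pi, weightProd q θ * (contHermite q (2 * r)).eval (Real.cos θ) =
      Real.pi * ((qPochInfty q)⁻¹ * if r = 0 then 2 else 0) := by
  have hint : ∀ N : ℕ, ∀ θ : ℝ,
      aeval (Complex.exp (θ * Complex.I) ^ 2)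
        (rogersSzego q (2 * r) * (thetaPoly q N N * (X - 1))) *
        Complex.exp (-(θ * Complex.I)) ^ (2 * (N + r + 1)) =
      ((∏ k ∈ range N, weightFactor q θ k : ℝ) : ℂ) *
        (1 - q ^ N * Complex.exp (-(θ * Complex.I)) ^ 2) *
        (((contHermite q (2 * r)).eval (Real.cos θ) : ℝ) : ℂ) := by
    intro N θ
    have huv : Complex.exp (θ * Complex.I) * Complex.exp (-(θ * Complex.I)) = 1 := by
      rw [← Complex.exp_add]
      simp
    rw [← aeval_thetaPoly q θ N rfl rfl, map_mul, aeval_rogersSzego q (2 * r) huv,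
      exp_mul_I_add_exp_neg]
    have h1 : aeval ((Real.cos θ : ℝ) : ℂ) (contHermite q (2 * r)) =
        (((contHermite q (2 * r)).eval (Real.cos θ) : ℝ) : ℂ) := by
      rw [← coe_aeval_eq_eval]
      exact aeval_algebraMap_apply ℂ (Real.cos θ) (contHermite q (2 * r))
    have h2 : Complex.exp (θ * Complex.I) ^ (2 * r) * Complex.exp (-(θ * Complex.I)) ^ (2 * r) =
        1 := by rw [← mul_pow, huv, one_pow]
    -- Of the exponent, `2 * (N + 1)` normalizes the theta product and `2 * r` the Hermite
    -- polynomial.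
    rw [show 2 * (N + r + 1) = 2 * (N + 1) + 2 * r by ring, pow_add, h1]
    linear_combination (aeval (Complex.exp (θ * Complex.I) ^ 2) (thetaPoly q N N * (X - 1)) *
      Complex.exp (-(θ * Complex.I)) ^ (2 * (N + 1)) *
      (((contHermite q (2 * r)).eval (Real.cos θ) : ℝ) : ℂ)) * h2
  have hlim : Tendsto (fun N : ℕ => ∫ θ in (0 : ℝ)..Real.pi,
      ((∏ k ∈ range N, weightFactor q θ k : ℝ) : ℂ) *
        (1 - q ^ N * Complex.exp (-(θ * Complex.I)) ^ 2) *
        (((contHermite q (2 * r)).eval (Real.cos θ) : ℝ) : ℂ)) atTop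
      (𝓝 (∫ θ in (0 : ℝ)..Real.pi, (weightProd q θ : ℂ) * 1 *
        (((contHermite q (2 * r)).eval (Real.cos θ) : ℝ) : ℂ))) := by
    refine intervalIntegral.tendsto_integral_filter_of_dominated_convergence
      -- The factor 2 bounds `1 - q^N e^{-2iθ}`.
      (fun θ => Real.exp (∑' k, 2 * |q| ^ k) * 2 * |(contHermite q (2 * r)).eval (Real.cos θ)|) ?_ ?_ ?_ ?_
    · refine Eventually.of_forall fun N => Continuous.aestronglyMeasurable ?_
      unfold weightFactor
      fun_prop
    · refine Eventually.of_forall fun N => Eventually.of_forall fun θ _ => ?_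
      rw [norm_mul, norm_mul, Complex.norm_real, Complex.norm_real, Real.norm_eq_abs,
        Real.norm_eq_abs]
      gcongr
      · exact abs_prod_weightFactor_le hq θ N
      · refine (norm_sub_le _ _).trans ?_
        have h1 : ‖Complex.exp (-(θ * Complex.I))‖ = 1 := by
          rw [Complex.norm_exp]
          simp
        rw [norm_mul, norm_pow, norm_pow, h1, norm_one, Complex.norm_real, Real.norm_eq_abs]
        have := pow_le_one₀ (abs_nonneg q) hq.le (n := N)
        linarith
    · apply Continuous.intervalIntegrable
      fun_prop
    · refine Eventually.of_forall fun θ _ => Tendsto.mul_const _ (Tendsto.mul ?_ ?_)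
      · exact (Complex.continuous_ofReal.tendsto _).comp (tendsto_prod_weightFactor hq θ)
      · have h1 : Tendsto (fun N : ℕ => (q : ℂ) ^ N) atTop (𝓝 0) :=
          tendsto_pow_atTop_nhds_zero_of_norm_lt_one (by simpa using hq)
        simpa using (h1.mul_const (Complex.exp (-(θ * Complex.I)) ^ 2)).const_sub 1
  simp only [← hint, integral_aeval_mul] at hlim
  have hlim' : Tendsto (fun N : ℕ => (Real.pi : ℂ) *
      (((rogersSzego q (2 * r) * (thetaPoly q N N * (X - 1))).coeff (N + r + 1) : ℝ) : ℂ)) atTop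
      (𝓝 ((Real.pi : ℂ) * (((qPochInfty q)⁻¹ * if r = 0 then 2 else 0 : ℝ) : ℂ))) :=
    ((Complex.continuous_ofReal.tendsto _).comp (tendsto_coeff_thetaPoly_mul hq
      (qPochInfty_ne_zero hq) (tendsto_qPoch hq) r)).const_mul _
  have h := tendsto_nhds_unique hlim hlim'
  simp only [mul_one, ← Complex.ofReal_mul] at h
  rw [intervalIntegral.integral_ofReal] at h
  exact_mod_cast h

end QHermite

namespace QHermite

/-! ### The substitution `x = 2 cos θ / √(1 - q)` -/

open Finset MeasureTheory

lemma abs_cos_lt_one {θ : ℝ} (hθ : θ ∈ Set.Ioo 0 Real.pi) : |Real.cos θ| < 1 := by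
  have h := Real.sin_pos_of_pos_of_lt_pi hθ.1 hθ.2
  rw [← sq_lt_one_iff_abs_lt_one]
  nlinarith [Real.sin_sq_add_cos_sq θ]

lemma image_mul_cos {c : ℝ} (hc : 0 < c) :
    (fun θ => c * Real.cos θ) '' Set.Ioo 0 Real.pi = Set.Ioo (-c) c := by
  ext x
  constructor
  · rintro ⟨θ, hθ, rfl⟩
    have h := abs_lt.1 (abs_cos_lt_one hθ)
    constructor <;> nlinarith
  · rintro ⟨h1, h2⟩
    have h3 : -1 < x / c := by rw [lt_div_iff₀ hc]; linarith
    have h4 : x / c < 1 := by rw [div_lt_iff₀ hc]; linarith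
    refine ⟨Real.arccos (x / c), ⟨Real.arccos_pos.2 h4, ?_⟩, ?_⟩
    · exact lt_of_le_of_ne (Real.arccos_le_pi _) fun h => by
        rw [Real.arccos_eq_pi] at h
        linarith
    · simp only
      rw [Real.cos_arccos h3.le h4.le]
      field_simp

lemma injOn_mul_cos {c : ℝ} (hc : 0 < c) :
    Set.InjOn (fun θ => c * Real.cos θ) (Set.Ioo 0 Real.pi) := fun _ ha _ hb h =>
  Real.injOn_cos ⟨ha.1.le, ha.2.le⟩ ⟨hb.1.le, hb.2.le⟩ (mul_left_cancel₀ hc.ne' h)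

lemma hasDerivWithinAt_mul_cos (c : ℝ) (s : Set ℝ) (θ : ℝ) :
    HasDerivWithinAt (fun θ => c * Real.cos θ) (c * -Real.sin θ) s θ :=
  ((Real.hasDerivAt_cos θ).const_mul c).hasDerivWithinAt

/-- The square root in the denominator of the weight becomes `sin θ` and cancels the Jacobian. -/
lemma abs_mul_weight {q : ℝ} (hq : q < 1) {θ : ℝ} (hθ : θ ∈ Set.Ioo 0 Real.pi) :
    |2 / √(1 - q) * -Real.sin θ| * weight q (2 / √(1 - q) * Real.cos θ) =
      qPochInfty q / (2 * Real.pi) * weightProd q θ := by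
  have hpos : 0 < √(1 - q) := Real.sqrt_pos.2 (by linarith)
  have hsq : √(1 - q) ^ 2 = 1 - q := Real.sq_sqrt (by linarith)
  have hsin := Real.sin_pos_of_pos_of_lt_pi hθ.1 hθ.2
  have hx : (2 / √(1 - q) * Real.cos θ) ^ 2 * (1 - q) = 4 * Real.cos θ ^ 2 := by
    rw [mul_pow, div_pow, hsq]
    have : 1 - q ≠ 0 := by linarith
    field_simp
    ring
  have hs : √(1 - (1 - q) * (2 / √(1 - q) * Real.cos θ) ^ 2 / 4) = Real.sin θ := by
    rw [mul_comm (1 - q), hx, show 1 - 4 * Real.cos θ ^ 2 / 4 = Real.sin θ ^ 2 by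
      linarith [Real.sin_sq_add_cos_sq θ], Real.sqrt_sq hsin.le]
  have hlt : |2 / √(1 - q) * Real.cos θ| < 2 / √(1 - q) := by
    rw [abs_mul, abs_of_pos (by positivity)]
    exact mul_lt_of_lt_one_right (by positivity) (abs_cos_lt_one hθ)
  have hw : ∏' k : ℕ, (1 + (2 - (2 / √(1 - q) * Real.cos θ) ^ 2 * (1 - q)) * q ^ k +
      q ^ (2 * k)) = weightProd q θ := by
    rw [hx]
    rfl
  have habs : |2 / √(1 - q) * -Real.sin θ| = 2 / √(1 - q) * Real.sin θ := by
    rw [mul_neg, abs_neg, abs_of_pos (by positivity)]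
  rw [weight, if_pos hlt, hw, hs, habs]
  have := Real.pi_pos
  field_simp
  ring

lemma rescaledHermite_comp {q : ℝ} (hq : q < 1) (n : ℕ) (θ : ℝ) :
    rescaledHermite q n (2 / √(1 - q) * Real.cos θ) =
      (contHermite q n).eval (Real.cos θ) / √(1 - q) ^ n := by
  have hpos : 0 < √(1 - q) := Real.sqrt_pos.2 (by linarith)
  rw [rescaledHermite, show 1 / 2 * √(1 - q) * (2 / √(1 - q) * Real.cos θ) = Real.cos θ by
    field_simp]

lemma abs_smul_weight_mul {q : ℝ} (hq : q < 1) (n : ℕ) {θ : ℝ} (hθ : θ ∈ Set.Ioo 0 Real.pi) :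
    |2 / √(1 - q) * -Real.sin θ| • (weight q (2 / √(1 - q) * Real.cos θ) *
        rescaledHermite q n (2 / √(1 - q) * Real.cos θ)) =
      qPochInfty q / (2 * Real.pi) / √(1 - q) ^ n *
        (weightProd q θ * (contHermite q n).eval (Real.cos θ)) := by
  rw [smul_eq_mul, ← mul_assoc, abs_mul_weight hq hθ, rescaledHermite_comp hq]
  ring

lemma weight_mul_eq_indicator (q : ℝ) (f : ℝ → ℝ) :
    (fun x => weight q x * f x) =
      (Set.Ioo (-(2 / √(1 - q))) (2 / √(1 - q))).indicator fun x => weight q x * f x := by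
  funext x
  rw [Set.indicator_apply]
  split_ifs with h
  · rfl
  · rw [weight, if_neg (fun hx => h (abs_lt.1 hx)), zero_mul]

lemma integrable_weight_mul_rescaledHermite {q : ℝ} (hq : |q| < 1) (n : ℕ) :
    Integrable fun x => weight q x * rescaledHermite q n x := by
  have hq' : q < 1 := (abs_lt.1 hq).2
  have hpos : 0 < √(1 - q) := Real.sqrt_pos.2 (by linarith)
  rw [weight_mul_eq_indicator, integrable_indicator_iff measurableSet_Ioo,
    ← image_mul_cos (by positivity), integrableOn_image_iff_integrableOn_abs_deriv_smul
      measurableSet_Ioo (fun θ _ => hasDerivWithinAt_mul_cos _ _ θ) (injOn_mul_cos (by positivity))]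
  rw [integrableOn_congr_fun (fun θ hθ => abs_smul_weight_mul hq' n hθ) measurableSet_Ioo]
  refine Integrable.const_mul ?_ _
  have hcont : Continuous fun θ => (contHermite q n).eval (Real.cos θ) := by fun_prop
  refine Integrable.bdd_mul (c := Real.exp (∑' k, 2 * |q| ^ k)) ?_
    (measurable_weightProd hq).aestronglyMeasurable
    (Filter.Eventually.of_forall fun θ => abs_weightProd_le hq θ)
  exact (hcont.integrableOn_Icc (a := 0) (b := Real.pi)).mono_set Set.Ioo_subset_Icc_self

/-! ### Parity and orthogonality to constants -/

lemma eval_neg_contHermite (q : ℝ) (n : ℕ) (x : ℝ) :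
    (contHermite q n).eval (-x) = (-1) ^ n * (contHermite q n).eval x := by
  induction n using Nat.twoStepInduction with
  | zero => simp [contHermite]
  | one => simp [contHermite]
  | more n ih1 ih2 =>
    simp only [contHermite, Polynomial.eval_sub, Polynomial.eval_mul, Polynomial.eval_C,
      Polynomial.eval_X, Polynomial.eval_ofNat, ih1, ih2]
    ring

lemma weight_neg (q x : ℝ) : weight q (-x) = weight q x := by
  simp only [weight, abs_neg, neg_sq]

lemma rescaledHermite_neg (q : ℝ) (n : ℕ) (x : ℝ) :
    rescaledHermite q n (-x) = (-1) ^ n * rescaledHermite q n x := by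
  rw [rescaledHermite, mul_neg, eval_neg_contHermite, rescaledHermite, mul_div_assoc]

/-- The polynomial `H̃_n` is orthogonal to `H̃_0 = 1` for `n > 0`, and the weight has mass one. -/
lemma integral_weight_mul_rescaledHermite {q : ℝ} (hq : |q| < 1) (n : ℕ) :
    ∫ x, weight q x * rescaledHermite q n x = if n = 0 then 1 else 0 := by
  have hq' : q < 1 := (abs_lt.1 hq).2
  have hpos : 0 < √(1 - q) := Real.sqrt_pos.2 (by linarith)
  rcases Nat.even_or_odd' n with ⟨r, rfl | rfl⟩
  · have hP := qPochInfty_ne_zero hq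
    rw [weight_mul_eq_indicator, integral_indicator measurableSet_Ioo,
      ← image_mul_cos (by positivity), integral_image_eq_integral_abs_deriv_smul
        measurableSet_Ioo (fun θ _ => hasDerivWithinAt_mul_cos _ _ θ)
        (injOn_mul_cos (by positivity)),
      setIntegral_congr_fun measurableSet_Ioo (fun θ hθ => abs_smul_weight_mul hq' (2 * r) hθ),
      integral_const_mul, ← integral_Ioc_eq_integral_Ioo,
      ← intervalIntegral.integral_of_le Real.pi_pos.le,
      integral_weightProd_mul_contHermite_even hq]
    have := Real.pi_pos
    rcases Nat.eq_zero_or_pos r with rfl | hr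
    -- The mass is `P / (2π) * π * (2 / P) = 1` with `P = qPochInfty q`.
    · simp only [mul_zero, pow_zero, if_true]
      field_simp
    · rw [if_neg hr.ne', if_neg (by omega)]
      simp
  -- In odd degree the integrand is odd, so the integral equals its own negative.
  · have h := integral_neg_eq_self (fun x => weight q x * rescaledHermite q (2 * r + 1) x) volume
    simp only [weight_neg, rescaledHermite_neg] at h
    rw [if_neg (by omega)]
    have h2 : ∀ x, weight q x * ((-1) ^ (2 * r + 1) * rescaledHermite q (2 * r + 1) x) =
        -(weight q x * rescaledHermite q (2 * r + 1) x) := fun x => by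
      rw [pow_succ, pow_mul]
      simp
    simp only [h2, integral_neg] at h
    linarith

end QHermite

open QHermite

theorem mainTheorem1 (q : ℝ) (hq₁ : -1 < q) (hq₂ : q < 1) (m : ℕ) (n : Fin m → ℕ) :
    MeasureTheory.Integrable
        (fun x : ℝ => QHermite.weight q x * ∏ j, QHermite.rescaledHermite q (n j) x) ∧
      QHermite.K n q =
        ∫ x : ℝ, QHermite.weight q x * ∏ j, QHermite.rescaledHermite q (n j) x := by
  have hq : |q| < 1 := abs_lt.2 ⟨hq₁, hq₂⟩
  have hint : ∀ A ∈ partialMatchings (Separated n) (∑ j, n j), MeasureTheory.Integrable fun x =>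
      q ^ openCr (∑ j, n j) A *
        (weight q x * rescaledHermite q (openPts (∑ j, n j) A).card x) := fun A _ =>
    (integrable_weight_mul_rescaledHermite hq _).const_mul _
  simp only [prod_rescaledHermite hq₂, Finset.mul_sum, mul_left_comm (weight q _)]
  refine ⟨MeasureTheory.integrable_finsetSum _ hint, ?_⟩
  rw [MeasureTheory.integral_finsetSum _ hint, K_eq_sum_partialMatchings, Finset.sum_filter]
  refine Finset.sum_congr rfl fun A _ => ?_
  rw [MeasureTheory.integral_const_mul, integral_weight_mul_rescaledHermite hq]
  simp only [Finset.card_eq_zero, mul_ite, mul_one, mul_zero]
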